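/- Let $V$ be Thompson's group of homeomorphisms of the Cantor set $\{0,1\}^{\mathbb N}$ that are represented by tree diagrams $(T_+,\sigma,T_-)$. Here $T_+,T_-$ are finite full rooted plane binary trees with the same number $n$ of leaves, numbered from left to right, and $\sigma$ is a permutation of $\{1,\dots,n\}$. Label the left edge of every caret by $0$ and the right edge by $1$. Each leaf is then described by a finite binary word, read from the root to the leaf. The diagram represents the homeomorphism that, for each $i$, sends $\ell_i w$ to $\ell'_{\sigma(i)}w$ for every infinite binary word $w$, where $\ell_i$ is the word of the $i$-th leaf of $T_+$ and $\ell'_j$ is the word of the $j$-th leaf of $T_-$; the pair $\ell_i\to\ell'_{\sigma(i)}$ is called a branch of the diagram. Products are compositions from left to right ($gh$ is first $g$, then $h$). The subgroup $T\le V$ (respectively $F\le V$) consists of the elements represented by a tree diagram in which $\sigma$ is a cyclic permutation, i.e. a rotation $i\mapsto i+k \bmod n$ (respectively, the identity). A tree diagram is reduced if there are no finite binary words $u,v$ for which $u0\to v0$ and $u1\to v1$ are both branches of it. Every $g\in V$ is represented by a unique reduced tree diagram, and $\mathcal N(g)$ denotes the number of leaves of each of its two trees. Define elements by their branches as follows: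 $x_0$ by $00\to0,\ 01\to10,\ 1\to11$; $x_1$ by $0\to0,\ 100\to10,\ 101\to110,\ 11\to111$; $c_1$ by $0\to11,\ 10\to0,\ 11\to10$; $\pi_0$ by $0\to10,\ 10\to0,\ 11\to11$. Let $(\mathcal G,X)$ be one of $(F,\{x_0,x_1\})$, $(T,\{x_0,x_1,c_1\})$, $(V,\{x_0,x_1,c_1,\pi_0\})$; in each case $X$ is the standard generating set of $\mathcal G$. Let $|g|$ be the word length of $g\in\mathcal G$ with respect to $X$, and let $\Gamma=\mathrm{Cay}(\mathcal G,X)$ be the Cayley graph, in which $g$ is joined to $gx^{\pm1}$ for $x\in X$. Theorem. There exist constants $\delta,D>0$ such that for any two elements $g_1,g_2\in\mathcal G$ with $\mathcal N(g_1),\mathcal N(g_2)\ge4$ there is a path in $\Gamma$ from $g_1$ to $g_2$ of length at most $D(|g_1|+|g_2|)$ all of whose vertices $v$ satisfy $|v|>\delta\min\{|g_1|,|g_2|\}$. -/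

import Mathlib

namespace Thompson

/-! ### The Cantor set, plane binary trees, branches -/

/-- The Cantor set of infinite binary words, with the product topology
(`false` is the letter `0`, `true` is the letter `1`). -/
abbrev Cantor : Type := ℕ → Bool

/-- Finite binary words. -/
abbrev Word : Type := List Bool

/-- Finite full rooted plane binary trees: `nil` is the one-leaf tree and
`node () l r` is a caret carrying `l` below its left edge and `r` below its right edge. -/
abbrev PlaneTree : Type := BinaryTree Unit

/-- `b w`: the infinite word `w` with the letter `b` put in front. -/
def consWord (b : Bool) (w : Cantor) : Cantor
  | 0 => b
  | n + 1 => w n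

/-- `u w`: the infinite word `w` with the finite word `u` put in front. -/
def prepend (u : Word) (w : Cantor) : Cantor := u.foldr consWord w

/-- The branches of a tree (the words labelling the paths from the root to the leaves),
listed from left to right. Leaves are identified with positions in this list. -/
def branches : PlaneTree → List Word
  | .nil => [[]]
  | .node _ l r => (branches l).map (List.cons false) ++ (branches r).map (List.cons true)

theorem prepend_nil (w : Cantor) : prepend [] w = w := rfl

theorem prepend_cons (b : Bool) (u : Word) (w : Cantor) :
    prepend (b :: u) w = consWord b (prepend u w) := rfl

theorem prepend_append (u v : Word) (w : Cantor) :
    prepend (u ++ v) w = prepend u (prepend v w) := by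
  simp [prepend]

theorem consWord_inj {b c : Bool} {w z : Cantor} (h : consWord b w = consWord c z) :
    b = c ∧ w = z :=
  ⟨congrFun h 0, funext fun n => congrFun h (n + 1)⟩

theorem consWord_eta (x : Cantor) : consWord (x 0) (fun n => x (n + 1)) = x := by
  funext n; cases n <;> rfl

theorem prepend_injective (u : Word) : Function.Injective (prepend u) := by
  induction u with
  | nil => exact fun _ _ h => h
  | cons b u ih => exact fun _ _ h => ih (consWord_inj h).2

theorem continuous_consWord (b : Bool) : Continuous (consWord b) := by
  refine continuous_pi fun n => ?_
  cases n with
  | zero => exact continuous_const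
  | succ n => exact continuous_apply n

theorem continuous_prepend (u : Word) : Continuous (prepend u) := by
  induction u with
  | nil => exact continuous_id
  | cons b u ih => exact (continuous_consWord b).comp ih

theorem branches_nodup (T : PlaneTree) : (branches T).Nodup := by
  induction T with
  | nil => simp [branches]
  | node a l r ihl ihr =>
    rw [branches, List.nodup_append]
    refine ⟨ihl.map (List.cons_injective), ihr.map (List.cons_injective), ?_⟩
    intro x hx y hy hxy
    simp only [List.mem_map] at hx hy
    obtain ⟨_, _, rfl⟩ := hx
    obtain ⟨_, _, rfl⟩ := hy
    simp at hxy

theorem exists_branch (T : PlaneTree) (x : Cantor) :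
    ∃ u ∈ branches T, ∃ w, prepend u w = x := by
  induction T generalizing x with
  | nil => exact ⟨[], by simp [branches], x, rfl⟩
  | node a l r ihl ihr =>
    cases hx : x 0 with
    | false =>
      obtain ⟨u, hu, w, hw⟩ := ihl (fun n => x (n + 1))
      refine ⟨false :: u, by simp [branches, hu], w, ?_⟩
      rw [prepend_cons, hw, ← hx, consWord_eta]
    | true =>
      obtain ⟨u, hu, w, hw⟩ := ihr (fun n => x (n + 1))
      refine ⟨true :: u, by simp [branches, hu], w, ?_⟩
      rw [prepend_cons, hw, ← hx, consWord_eta]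

theorem branch_unique (T : PlaneTree) {u v : Word} (hu : u ∈ branches T) (hv : v ∈ branches T)
    {w z : Cantor} (h : prepend u w = prepend v z) : u = v := by
  induction T generalizing u v with
  | nil => simp [branches] at hu hv; rw [hu, hv]
  | node a l r ihl ihr =>
    simp only [branches, List.mem_append, List.mem_map] at hu hv
    rcases hu with ⟨u, hu, rfl⟩ | ⟨u, hu, rfl⟩ <;> rcases hv with ⟨v, hv, rfl⟩ | ⟨v, hv, rfl⟩ <;>
      rw [prepend_cons, prepend_cons] at h <;> obtain ⟨h0, h1⟩ := consWord_inj h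
    · rw [ihl hu hv h1]
    · simp at h0
    · simp at h0
    · rw [ihr hu hv h1]

/-- The Cantor set cut along the leaves of a tree: `(i, w)` goes to `ℓ_i w`,
where `ℓ_i` is the `i`-th branch. -/
noncomputable def leafEquiv (T : PlaneTree) : Fin (branches T).length × Cantor ≃ Cantor :=
  Equiv.ofBijective (fun p => prepend ((branches T).get p.1) p.2) <| by
    constructor
    · rintro ⟨i, w⟩ ⟨j, z⟩ h
      have h' : prepend ((branches T).get i) w = prepend ((branches T).get j) z := h
      have hij := branch_unique T (List.get_mem _ i) (List.get_mem _ j) h'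
      have : i = j := (branches_nodup T).injective_get hij
      subst this
      rw [prepend_injective _ h']
    · intro x
      obtain ⟨u, hu, w, hw⟩ := exists_branch T x
      obtain ⟨i, hi⟩ := List.get_of_mem hu
      exact ⟨(i, w), by rw [← hw, ← hi]⟩

theorem leafEquiv_apply (T : PlaneTree) (i : Fin (branches T).length) (w : Cantor) :
    leafEquiv T (i, w) = prepend ((branches T).get i) w := rfl

theorem continuous_leafEquiv (T : PlaneTree) : Continuous (leafEquiv T) :=
  continuous_prod_of_discrete_left.mpr fun i => continuous_prepend ((branches T).get i)

/-- `leafEquiv` as a homeomorphism. -/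
noncomputable def leafHomeo (T : PlaneTree) : Fin (branches T).length × Cantor ≃ₜ Cantor :=
  (continuous_leafEquiv T).homeoOfEquivCompactToT2

/-! ### Tree diagrams -/

/-- A tree diagram `(T₊, σ, T₋)`: two trees with a bijection from the leaves of the first
(numbered from left to right) to the leaves of the second. -/
structure TreeDiagram where
  /-- the tree `T₊` -/
  dom : PlaneTree
  /-- the tree `T₋` -/
  ran : PlaneTree
  /-- the permutation `σ` -/
  perm : Fin (branches dom).length ≃ Fin (branches ran).length

namespace TreeDiagram

/-- The number of leaves of (each of the trees of) a tree diagram. -/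
def numLeaves (D : TreeDiagram) : ℕ := (branches D.dom).length

/-- `u → v` is a branch of the tree diagram. -/
def IsBranch (D : TreeDiagram) (u v : Word) : Prop :=
  ∃ i, (branches D.dom).get i = u ∧ (branches D.ran).get (D.perm i) = v

/-- The diagram has no dipole, that is, no pair of branches `u0 → v0`, `u1 → v1`. -/
def IsReduced (D : TreeDiagram) : Prop :=
  ¬ ∃ u v : Word, D.IsBranch (u ++ [false]) (v ++ [false]) ∧ D.IsBranch (u ++ [true]) (v ++ [true])

/-- The homeomorphism of the Cantor set that sends `u w` to `v w` for every branch `u → v` of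
the diagram and every infinite word `w`. -/
noncomputable def toHomeo (D : TreeDiagram) : Cantor ≃ₜ Cantor where
  toEquiv := (leafEquiv D.dom).symm.trans
    ((D.perm.prodCongr (Equiv.refl Cantor)).trans (leafEquiv D.ran))
  continuous_toFun := by
    refine (continuous_leafEquiv D.ran).comp (Continuous.comp ?_ (leafHomeo D.dom).symm.continuous)
    exact (continuous_of_discreteTopology (f := D.perm)).prodMap continuous_id
  continuous_invFun := by
    exact (continuous_leafEquiv D.dom).comp
      (((continuous_of_discreteTopology (f := D.perm.symm)).prodMap continuous_id).comp
        (leafHomeo D.ran).symm.continuous)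

theorem toHomeo_prepend (D : TreeDiagram) (i : Fin (branches D.dom).length) (w : Cantor) :
    D.toHomeo (prepend ((branches D.dom).get i) w) =
      prepend ((branches D.ran).get (D.perm i)) w := by
  change (leafEquiv D.ran) ((D.perm.prodCongr (Equiv.refl Cantor))
    ((leafEquiv D.dom).symm (leafEquiv D.dom (i, w)))) = _
  rw [Equiv.symm_apply_apply]
  rfl

end TreeDiagram

/-- The three groups of Thompson. -/
inductive Kind
  | F
  | T
  | V

/-- The condition on the permutation `σ` of a tree diagram: it is the identity for `F`,
a cyclic permutation (a power of the rotation of the leaves) for `T`, arbitrary for `V`. -/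
def TreeDiagram.HasKind (D : TreeDiagram) : Kind → Prop
  | .F => ∀ i, (D.perm i : ℕ) = i
  | .T => ∃ k : ℕ, ∀ i, (D.perm i : ℕ) = (i + k) % D.numLeaves
  | .V => True

/-! ### The homeomorphisms of a given kind form a group -/

/-- Two lists of words agree, agree up to rotation, agree up to order. -/
def Kind.Rel : Kind → List Word → List Word → Prop
  | .F, l, m => l = m
  | .T, l, m => l ~r m
  | .V, l, m => l.Perm m

theorem Kind.Rel.symm {K : Kind} {l m : List Word} (h : K.Rel l m) : K.Rel m l := by
  cases K
  · exact Eq.symm h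
  · exact List.IsRotated.symm h
  · exact List.Perm.symm h

theorem Kind.Rel.trans {K : Kind} {l m n : List Word} (h : K.Rel l m) (h' : K.Rel m n) :
    K.Rel l n := by
  cases K
  · exact Eq.trans h h'
  · exact List.IsRotated.trans h h'
  · exact List.Perm.trans h h'

theorem Kind.Rel.refl (K : Kind) (l : List Word) : K.Rel l l := by
  cases K
  · rfl
  · exact List.IsRotated.refl l
  · exact List.Perm.refl l

theorem Kind.Rel.perm {K : Kind} {l m : List Word} (h : K.Rel l m) : l.Perm m := by
  cases K
  · exact h ▸ List.Perm.refl l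
  · exact List.IsRotated.perm h
  · exact h

theorem Kind.Rel.flatMap {K : Kind} {l m : List Word} (h : K.Rel l m) (f : Word → List Word) :
    K.Rel (l.flatMap f) (m.flatMap f) := by
  cases K
  · exact congrArg (List.flatMap f) h
  · obtain ⟨k, hk⟩ := (h : l ~r m)
    change l.flatMap f ~r m.flatMap f
    rw [← hk, List.rotate_eq_drop_append_take_mod, List.flatMap_append]
    conv_lhs => rw [← List.take_append_drop (k % l.length) l, List.flatMap_append]
    exact List.isRotated_append
  · exact List.Perm.flatMap_right f h

theorem Kind.Rel.map {K : Kind} {l m : List Word} (h : K.Rel l m) (f : Word → Word) :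
    K.Rel (l.map f) (m.map f) := by
  have h1 : ∀ n : List Word, n.map f = n.flatMap fun u => [f u] := fun n =>
    List.map_eq_flatMap
  rw [h1, h1]
  exact h.flatMap _

/-- `g` takes the branch `u` onto `v`. -/
def Takes (g : Cantor ≃ₜ Cantor) (u v : Word) : Prop := ∀ w, g (prepend u w) = prepend v w

theorem prepend_word_injective {u v : Word} (h : ∀ w, prepend u w = prepend v w) : u = v := by
  induction u generalizing v with
  | nil =>
    cases v with
    | nil => rfl
    | cons b v =>
      have := congrFun (h (fun _ => !b)) 0
      simp [prepend, consWord] at this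
  | cons b u ih =>
    cases v with
    | nil =>
      have := congrFun (h (fun _ => !b)) 0
      simp [prepend, consWord] at this
    | cons c v =>
      have h1 := fun w => consWord_inj (h w)
      rw [(h1 fun _ => false).1, ih fun w => (h1 w).2]

theorem Takes.unique {g : Cantor ≃ₜ Cantor} {u v v' : Word} (h : Takes g u v)
    (h' : Takes g u v') : v = v' :=
  prepend_word_injective fun w => (h w).symm.trans (h' w)

theorem Takes.append {g : Cantor ≃ₜ Cantor} {u v : Word} (h : Takes g u v) (x : Word) :
    Takes g (u ++ x) (v ++ x) := fun w => by
  rw [prepend_append, h, prepend_append]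

theorem Takes.symm {g : Cantor ≃ₜ Cantor} {u v : Word} (h : Takes g u v) :
    Takes g.symm v u := fun w => by
  rw [← h w, Homeomorph.symm_apply_apply]

theorem Takes.trans {g h : Cantor ≃ₜ Cantor} {u v x : Word} (hg : Takes g u v)
    (hh : Takes h v x) : Takes (g.trans h) u x := fun w => by
  rw [Homeomorph.trans_apply, hg, hh]

open Classical in
/-- The word onto which `g` takes `u`, if there is one. -/
noncomputable def target (g : Cantor ≃ₜ Cantor) (u : Word) : Word :=
  if h : ∃ v, Takes g u v then h.choose else []

theorem Takes.target_eq {g : Cantor ≃ₜ Cantor} {u v : Word} (h : Takes g u v) :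
    target g u = v := by
  have hex : ∃ v, Takes g u v := ⟨v, h⟩
  rw [target, dif_pos hex]
  exact hex.choose_spec.unique h

/-- `g` is given by a diagram of kind `K` on the trees `A` and `B`. -/
def Rep (K : Kind) (g : Cantor ≃ₜ Cantor) (A B : PlaneTree) : Prop :=
  (∀ u ∈ branches A, Takes g u (target g u)) ∧ K.Rel ((branches A).map (target g)) (branches B)

/-- Hang the tree `f u` on every leaf `u` of a tree. -/
def graft : PlaneTree → (Word → PlaneTree) → PlaneTree
  | .nil, f => f []
  | .node _ l r, f =>
    .node () (graft l fun u => f (false :: u)) (graft r fun u => f (true :: u))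

theorem branches_graft (T : PlaneTree) (f : Word → PlaneTree) :
    branches (graft T f) = (branches T).flatMap fun u => (branches (f u)).map (u ++ ·) := by
  induction T generalizing f with
  | nil => simp [graft, branches]
  | node a l r ihl ihr =>
    simp [graft, branches, ihl, ihr, List.map_flatMap, List.flatMap_map, Function.comp_def]

theorem exists_common_refinement (S T : PlaneTree) : ∃ f f', graft S f = graft T f' := by
  induction S generalizing T with
  | nil =>
    refine ⟨fun _ => T, fun _ => .nil, ?_⟩
    have : ∀ T : PlaneTree, graft T (fun _ => .nil) = T := by
      intro T
      induction T with
      | nil => rfl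
      | node a l r ihl ihr => rw [graft, ihl, ihr]
    rw [this]; rfl
  | node a l r ihl ihr =>
    cases T with
    | nil =>
      refine ⟨fun _ => .nil, fun _ => graft (.node a l r) fun _ => .nil, rfl⟩
    | node a' l' r' =>
      obtain ⟨f₁, f₁', h₁⟩ := ihl l'
      obtain ⟨f₂, f₂', h₂⟩ := ihr r'
      refine ⟨fun u => if u.head? = some false then f₁ u.tail else f₂ u.tail,
        fun u => if u.head? = some false then f₁' u.tail else f₂' u.tail, ?_⟩
      simp [graft, h₁, h₂]

theorem Rep.symm {K : Kind} {g : Cantor ≃ₜ Cantor} {A B : PlaneTree} (h : Rep K g A B) :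
    Rep K g.symm B A := by
  obtain ⟨h₁, h₂⟩ := h
  refine ⟨fun v hv => ?_, ?_⟩
  · rw [← h₂.perm.mem_iff, List.mem_map] at hv
    obtain ⟨u, hu, rfl⟩ := hv
    rw [(h₁ u hu).symm.target_eq]
    exact (h₁ u hu).symm
  · have h₃ := (h₂.map (target g.symm)).symm
    have h₄ : ((branches A).map (target g)).map (target g.symm) = branches A := by
      rw [List.map_map]
      refine (List.map_congr_left fun u hu => ?_).trans (List.map_id _)
      exact (h₁ u hu).symm.target_eq
    rwa [h₄] at h₃

theorem Rep.graft_right {K : Kind} {g : Cantor ≃ₜ Cantor} {A B : PlaneTree} (h : Rep K g A B)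
    (f : Word → PlaneTree) : Rep K g (graft A fun u => f (target g u)) (graft B f) := by
  obtain ⟨h₁, h₂⟩ := h
  have key : ∀ u ∈ branches A, ∀ x, Takes g (u ++ x) (target g u ++ x) :=
    fun u hu x => (h₁ u hu).append x
  refine ⟨fun z hz => ?_, ?_⟩
  · rw [branches_graft, List.mem_flatMap] at hz
    obtain ⟨u, hu, hz⟩ := hz
    rw [List.mem_map] at hz
    obtain ⟨x, -, rfl⟩ := hz
    rw [(key u hu x).target_eq]
    exact key u hu x
  · rw [branches_graft, branches_graft]
    have h₃ := h₂.flatMap fun v => (branches (f v)).map (v ++ ·)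
    rw [List.flatMap_map] at h₃
    rw [List.map_flatMap]
    convert h₃ using 1
    rw [List.flatMap_def, List.flatMap_def]
    refine congrArg List.flatten (List.map_congr_left fun u hu => ?_)
    rw [List.map_map]
    exact List.map_congr_left fun x _ => (key u hu x).target_eq

theorem Rep.graft_left {K : Kind} {g : Cantor ≃ₜ Cantor} {A B : PlaneTree} (h : Rep K g A B)
    (f : Word → PlaneTree) : ∃ B', Rep K g (graft A f) B' :=
  ⟨_, (h.symm.graft_right f).symm⟩

theorem Rep.trans {K : Kind} {g h : Cantor ≃ₜ Cantor} {A B A' B' : PlaneTree}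
    (hg : Rep K g A B) (hh : Rep K h A' B') : ∃ A'' B'', Rep K (g.trans h) A'' B'' := by
  obtain ⟨f, f', hf⟩ := exists_common_refinement B A'
  obtain ⟨C, h₁, h₂⟩ := hh.graft_left f'
  obtain ⟨k₁, k₂⟩ := hg.graft_right f
  rw [hf] at k₂
  set A₁ := graft A fun u => f (target g u)
  have key : ∀ u ∈ branches A₁, Takes (g.trans h) u (target h (target g u)) := by
    intro u hu
    refine (k₁ u hu).trans (h₁ _ ?_)
    rw [← k₂.perm.mem_iff]
    exact List.mem_map_of_mem hu
  refine ⟨A₁, C, fun u hu => ?_, ?_⟩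
  · rw [(key u hu).target_eq]
    exact key u hu
  · have h₃ := (k₂.map (target h)).trans h₂
    rw [List.map_map] at h₃
    convert h₃ using 1
    exact List.map_congr_left fun u hu => (key u hu).target_eq

theorem TreeDiagram.takes (D : TreeDiagram) (i : Fin (branches D.dom).length) :
    Takes D.toHomeo ((branches D.dom).get i) ((branches D.ran).get (D.perm i)) :=
  D.toHomeo_prepend i

theorem TreeDiagram.length_eq (D : TreeDiagram) :
    (branches D.dom).length = (branches D.ran).length := by
  simpa using Fintype.card_congr D.perm

theorem TreeDiagram.HasKind.rep {D : TreeDiagram} {K : Kind} (h : D.HasKind K) :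
    Rep K D.toHomeo D.dom D.ran := by
  have hlen := D.length_eq
  have hget : ∀ (i : ℕ) (hi : i < (branches D.dom).length),
      target D.toHomeo ((branches D.dom)[i]) = (branches D.ran)[(D.perm ⟨i, hi⟩ : ℕ)] :=
    fun i hi => (D.takes ⟨i, hi⟩).target_eq
  refine ⟨fun u hu => ?_, ?_⟩
  · obtain ⟨i, rfl⟩ := List.get_of_mem hu
    rw [(D.takes i).target_eq]
    exact D.takes i
  · cases K with
    | F =>
      refine List.ext_getElem (by simpa using hlen) fun i hi hi' => ?_
      rw [List.length_map] at hi
      rw [List.getElem_map, hget i hi]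
      congr 1
      exact h ⟨i, hi⟩
    | T =>
      obtain ⟨k, hk⟩ := h
      refine List.IsRotated.symm ⟨k, ?_⟩
      refine List.ext_getElem (by simpa using hlen.symm) fun i hi hi' => ?_
      rw [List.length_map] at hi'
      rw [List.getElem_map, hget i hi', List.getElem_rotate]
      congr 1
      exact (congrArg ((i + k) % ·) hlen.symm).trans (hk ⟨i, hi'⟩).symm
    | V =>
      have hnd : ((branches D.dom).map (target D.toHomeo)).Nodup := by
        rw [List.nodup_iff_injective_get]
        intro i j hij
        have hi : (i : ℕ) < (branches D.dom).length := by simpa using i.2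
        have hj : (j : ℕ) < (branches D.dom).length := by simpa using j.2
        simp only [List.get_eq_getElem, List.getElem_map] at hij
        rw [hget i hi, hget j hj] at hij
        have h1 := (branches_nodup D.ran).injective_get
          (a₁ := D.perm ⟨i, hi⟩) (a₂ := D.perm ⟨j, hj⟩) hij
        have h2 := congrArg Fin.val (D.perm.injective h1)
        exact Fin.ext h2
      refine (List.perm_ext_iff_of_nodup hnd (branches_nodup _)).2 fun v => ?_
      rw [List.mem_map]
      constructor
      · rintro ⟨u, hu, rfl⟩
        obtain ⟨i, rfl⟩ := List.get_of_mem hu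
        rw [(D.takes i).target_eq]
        exact List.get_mem _ _
      · intro hv
        obtain ⟨j, rfl⟩ := List.get_of_mem hv
        refine ⟨_, List.get_mem _ (D.perm.symm j), ?_⟩
        rw [(D.takes _).target_eq, Equiv.apply_symm_apply]

theorem Rep.exists_diagram {K : Kind} {g : Cantor ≃ₜ Cantor} {A B : PlaneTree}
    (h : Rep K g A B) : ∃ D : TreeDiagram, D.HasKind K ∧ D.toHomeo = g := by
  classical
  obtain ⟨h₁, h₂⟩ := h
  have hp := h₂.perm
  have hlen : (branches A).length = (branches B).length := by simpa using hp.length_eq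
  have hnd : ((branches A).map (target g)).Nodup := hp.nodup_iff.2 (branches_nodup B)
  let e : Fin (branches A).length ≃ Fin (branches B).length :=
    (finCongr (by simp)).trans ((hnd.getEquiv _).trans
      ((Equiv.subtypeEquivRight fun x => hp.mem_iff).trans
        ((branches_nodup B).getEquiv _).symm))
  have he : ∀ i, (branches B).get (e i) = target g ((branches A).get i) := by
    intro i
    have : ((branches_nodup B).getEquiv _ (e i) : Word) = target g ((branches A).get i) := by
      simp [e]
    simpa using this
  refine ⟨⟨A, B, e⟩, ?_, ?_⟩
  · have huniq : ∀ (i : Fin (branches A).length) (j : ℕ) (hj : j < (branches B).length),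
        (branches B)[j] = target g ((branches A).get i) → (e i : ℕ) = j := by
      intro i j hj hij
      have h1 : (branches B).get (e i) = (branches B).get ⟨j, hj⟩ := (he i).trans hij.symm
      exact congrArg Fin.val ((branches_nodup B).injective_get h1)
    cases K with
    | F =>
      intro i
      have h3 : (branches A).map (target g) = branches B := h₂
      refine huniq i i (hlen ▸ i.2) ?_
      simp [← h3]
    | T =>
      obtain ⟨k, hk⟩ := List.IsRotated.symm h₂
      refine ⟨k, fun i => ?_⟩
      have hpos : 0 < (branches A).length := i.pos
      refine huniq i _ (hlen ▸ Nat.mod_lt _ hpos) ?_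
      have h3 : ((branches B).rotate k)[(i : ℕ)]'(by simp [← hlen]) =
          target g ((branches A).get i) := by
        simp [hk]
      rw [List.getElem_rotate] at h3
      rw [← h3]
      simp [TreeDiagram.numLeaves, hlen]
    | V => trivial
  · ext1 x
    obtain ⟨u, hu, w, rfl⟩ := exists_branch A x
    obtain ⟨i, rfl⟩ := List.get_of_mem hu
    refine (TreeDiagram.toHomeo_prepend ⟨A, B, e⟩ i w).trans ?_
    rw [h₁ _ hu w]
    exact congrArg (prepend · w) (he i)

/-! ### Thompson's groups -/

/-- The homeomorphisms of the Cantor set under composition from left to right: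
`g * h` is "first `g`, then `h`". -/
abbrev CantorGroup : Type := (Cantor ≃ₜ Cantor)ᵐᵒᵖ

/-- The element of the homeomorphism group that is represented by a tree diagram. -/
noncomputable def TreeDiagram.toGroup (D : TreeDiagram) : CantorGroup := .op D.toHomeo

/-- Thompson's group `F`, `T` or `V`: the elements represented by a tree diagram whose
permutation is the identity, cyclic, arbitrary, respectively. -/
def thompson (K : Kind) : Subgroup CantorGroup where
  carrier := {g | ∃ D : TreeDiagram, D.HasKind K ∧ D.toGroup = g}
  mul_mem' := by
    rintro _ _ ⟨D, hD, rfl⟩ ⟨E, hE, rfl⟩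
    obtain ⟨A, B, h⟩ := hD.rep.trans hE.rep
    obtain ⟨D', h1, h2⟩ := h.exists_diagram
    exact ⟨D', h1, congrArg MulOpposite.op h2⟩
  one_mem' := by
    have h0 : ∀ u, Takes (Homeomorph.refl Cantor) u u := fun u w => rfl
    have h : Rep K (Homeomorph.refl Cantor) .nil .nil := by
      refine ⟨fun u _ => by rw [(h0 u).target_eq]; exact h0 u, ?_⟩
      rw [show (branches .nil).map (target (Homeomorph.refl Cantor)) = branches .nil by
        simp [branches, (h0 _).target_eq]]
      exact Kind.Rel.refl _ _
    obtain ⟨D', h1, h2⟩ := h.exists_diagram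
    exact ⟨D', h1, congrArg MulOpposite.op h2⟩
  inv_mem' := by
    rintro _ ⟨D, hD, rfl⟩
    obtain ⟨D', h1, h2⟩ := hD.rep.symm.exists_diagram
    exact ⟨D', h1, congrArg MulOpposite.op h2⟩

/-- `𝒩(g)`: the number of leaves in each of the trees of the reduced tree diagram
representing `g`. -/
noncomputable def leafNumber (g : CantorGroup) : ℕ :=
  sInf {n | ∃ D : TreeDiagram, D.IsReduced ∧ D.toGroup = g ∧ D.numLeaves = n}

/-! ### The standard generators -/

/-- The tree with branches `0`, `10`, `11`. -/
def rightTree : PlaneTree := .node () .nil (.node () .nil .nil)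

/-- The tree with branches `00`, `01`, `1`. -/
def leftTree : PlaneTree := .node () (.node () .nil .nil) .nil

/-- `x₀`, with the branches `00 → 0`, `01 → 10`, `1 → 11`. -/
def diagramX0 : TreeDiagram := ⟨leftTree, rightTree, Equiv.refl (Fin 3)⟩

/-- `x₁`, with the branches `0 → 0`, `100 → 10`, `101 → 110`, `11 → 111`. -/
def diagramX1 : TreeDiagram :=
  ⟨.node () .nil leftTree, .node () .nil rightTree, Equiv.refl (Fin 4)⟩

/-- `c₁`, with the branches `0 → 11`, `10 → 0`, `11 → 10`. -/
def diagramC1 : TreeDiagram := ⟨rightTree, rightTree, (finRotate 3).symm⟩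

/-- `π₀`, with the branches `0 → 10`, `10 → 0`, `11 → 11`. -/
def diagramPi0 : TreeDiagram := ⟨rightTree, rightTree, (Equiv.swap 0 1 : Equiv.Perm (Fin 3))⟩

/-- The tree diagrams of the standard generators: `x₀, x₁` for `F`; `x₀, x₁, c₁` for `T`;
`x₀, x₁, c₁, π₀` for `V`. -/
def generatorDiagrams : Kind → Set TreeDiagram
  | .F => {diagramX0, diagramX1}
  | .T => {diagramX0, diagramX1, diagramC1}
  | .V => {diagramX0, diagramX1, diagramC1, diagramPi0}

/-- The standard generating set `X` of Thompson's group. -/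
def generators (K : Kind) : Set (thompson K) :=
  {g | ∃ D ∈ generatorDiagrams K, D.toGroup = (g : CantorGroup)}

/-- Every diagram in the list of generators does represent an element of the group. -/
theorem generatorDiagrams_mem (K : Kind) {D : TreeDiagram} (hD : D ∈ generatorDiagrams K) :
    D.toGroup ∈ thompson K := by
  refine ⟨D, ?_, rfl⟩
  cases K with
  | F => rcases hD with rfl | rfl <;> exact fun i => rfl
  | T =>
    rcases hD with rfl | rfl | rfl
    · exact ⟨0, fun i => (Nat.mod_eq_of_lt i.2).symm⟩
    · exact ⟨0, fun i => (Nat.mod_eq_of_lt i.2).symm⟩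
    · exact ⟨2, (by decide : ∀ i : Fin 3, ((finRotate 3).symm i : ℕ) = (i + 2) % 3)⟩
  | V => trivial

/-! ### Word length -/

/-- The word length of `g` with respect to `X`: the least length of a word in the letters
`x, x⁻¹` with `x ∈ X` whose value is `g`. -/
noncomputable def wordLength {G : Type*} [Group G] (X : Set G) (g : G) : ℕ :=
  sInf {n | ∃ w : List G, w.length = n ∧ (∀ a ∈ w, a ∈ X ∨ a⁻¹ ∈ X) ∧ w.prod = g}

end Thompson

namespace Thompson

/-! ### The right action on infinite words -/

/-! Call a word bad for `g` if `g` does not carry its cone onto a cone by exchange of prefixes. An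
element of a Thompson group has finitely many bad words. Their number is subadditive under products,
hence at most `C` times the word length (`exists_ncard_badWords_le`). Every lower bound for length
rests on this count, in one of two forms: an element that acts on some cone as `x₀ ^ n` has at least
`n` bad words (`ActsBy.le_ncard`), and a word of length `n` that is bad for `z⁻¹` brings its `n + 1`
prefixes with it.

Both elements are joined to the same far vertex `x₁ ^ n`, with `n` a large multiple of `|g₁| +
|g₂|`. Let `g` be one of them. Having many leaves, it has a letter `b` such that the cone of `!b` is
not the prefix-exchange image of a cone. Powers of `expand K b` enlarge the cone of `b` until it is
such an image, of the cone of some word `u`; meanwhile they push the bad cone deeper, so that long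
powers force long elements. The cone of `b` is then free for powers of a copy of `x₀` supported in
it. Each power adds bad words while the old one survives, so the walk to `w * copyX0 K b ^ n`, where
`w = g * expand K b ^ k`, never comes closer to the identity than a fixed fraction of `|g|`
(`exists_reach_copyX0_pow`).

It remains to forget `g` (`reach_change_cone`). The conjugate `w * copyX0 K b ^ n * w⁻¹` is
supported in the cone of `u`, hence in one half of the Cantor set, and commutes with the copy of
`x₀` in the other half. Multiplying by a power of that copy, commuting, and undoing the conjugate
leads to a power of the copy alone. Throughout, one of the two factors acts as `x₀ ^ n` on some
cone, up to detours of length `|w|`, so the walk stays far out.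

These estimates use the triangle inequality for word length, which needs the standard generators to
generate; this is proved by rotating trees for `F`, exchanging halves for `T`, and transposing
neighbouring leaves for `V`. -/

/-- `g` sends the cone of `u` onto the cone of `v` by exchange of prefixes. -/
def Sends (g : CantorGroup) (u v : Word) : Prop := Takes g.unop u v

theorem Sends.mul {g h : CantorGroup} {u v w : Word} (hg : Sends g u v) (hh : Sends h v w) :
    Sends (g * h) u w := Takes.trans hg hh

theorem Sends.inv {g : CantorGroup} {u v : Word} (hg : Sends g u v) : Sends g⁻¹ v u :=
  Takes.symm hg

theorem Sends.append {g : CantorGroup} {u v : Word} (hg : Sends g u v) (x : Word) :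
    Sends g (u ++ x) (v ++ x) := Takes.append hg x

theorem sends_one (u : Word) : Sends 1 u u := fun _ => rfl

theorem prepend_prefix {u v : Word} {w z : Cantor} (h : prepend u w = prepend v z)
    (hl : u.length ≤ v.length) : ∃ t, v = u ++ t ∧ w = prepend t z := by
  induction u generalizing v with
  | nil => exact ⟨v, rfl, h⟩
  | cons b u ih =>
    cases v with
    | nil => simp at hl
    | cons c v =>
      obtain ⟨rfl, h'⟩ := consWord_inj h
      obtain ⟨t, rfl, ht⟩ := ih h' (by simpa using hl)
      exact ⟨t, rfl, ht⟩

theorem Sends.source_unique {g : CantorGroup} {u u' v : Word} (h : Sends g u v)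
    (h' : Sends g u' v) : u = u' := Takes.unique h.inv h'.inv

/-- The generator `x₀`. -/
noncomputable def genX0 : CantorGroup := diagramX0.toGroup
/-- The generator `x₁`. -/
noncomputable def genX1 : CantorGroup := diagramX1.toGroup
/-- The generator `c₁`. -/
noncomputable def genC1 : CantorGroup := diagramC1.toGroup
/-- The generator `π₀`. -/
noncomputable def genPi0 : CantorGroup := diagramPi0.toGroup

theorem x0_00 (t : Word) : Sends genX0 (false :: false :: t) (false :: t) :=
  Sends.append (diagramX0.takes (⟨0, by decide⟩ : Fin 3)) t
theorem x0_01 (t : Word) : Sends genX0 (false :: true :: t) (true :: false :: t) :=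
  Sends.append (diagramX0.takes (⟨1, by decide⟩ : Fin 3)) t
theorem x0_1 (t : Word) : Sends genX0 (true :: t) (true :: true :: t) :=
  Sends.append (diagramX0.takes (⟨2, by decide⟩ : Fin 3)) t
theorem x1_0 (t : Word) : Sends genX1 (false :: t) (false :: t) :=
  Sends.append (diagramX1.takes (⟨0, by decide⟩ : Fin 4)) t
theorem x1_100 (t : Word) : Sends genX1 (true :: false :: false :: t) (true :: false :: t) :=
  Sends.append (diagramX1.takes (⟨1, by decide⟩ : Fin 4)) t
theorem x1_101 (t : Word) : Sends genX1 (true :: false :: true :: t) (true :: true :: false :: t) :=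
  Sends.append (diagramX1.takes (⟨2, by decide⟩ : Fin 4)) t
theorem x1_11 (t : Word) : Sends genX1 (true :: true :: t) (true :: true :: true :: t) :=
  Sends.append (diagramX1.takes (⟨3, by decide⟩ : Fin 4)) t
theorem c1_0 (t : Word) : Sends genC1 (false :: t) (true :: true :: t) := by
  have h := diagramC1.takes (0 : Fin 3)
  rw [show diagramC1.perm (0 : Fin 3) = (2 : Fin 3) from
    (by decide : (finRotate 3).symm (0 : Fin 3) = 2)] at h
  exact Sends.append h t
theorem c1_10 (t : Word) : Sends genC1 (true :: false :: t) (false :: t) := by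
  have h := diagramC1.takes (1 : Fin 3)
  rw [show diagramC1.perm (1 : Fin 3) = (0 : Fin 3) from
    (by decide : (finRotate 3).symm (1 : Fin 3) = 0)] at h
  exact Sends.append h t
theorem c1_11 (t : Word) : Sends genC1 (true :: true :: t) (true :: false :: t) := by
  have h := diagramC1.takes (2 : Fin 3)
  rw [show diagramC1.perm (2 : Fin 3) = (1 : Fin 3) from
    (by decide : (finRotate 3).symm (2 : Fin 3) = 1)] at h
  exact Sends.append h t
theorem pi0_0 (t : Word) : Sends genPi0 (false :: t) (true :: false :: t) :=
  Sends.append (diagramPi0.takes (⟨0, by decide⟩ : Fin 3)) t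
theorem pi0_10 (t : Word) : Sends genPi0 (true :: false :: t) (false :: t) :=
  Sends.append (diagramPi0.takes (⟨1, by decide⟩ : Fin 3)) t
theorem pi0_11 (t : Word) : Sends genPi0 (true :: true :: t) (true :: true :: t) :=
  Sends.append (diagramPi0.takes (⟨2, by decide⟩ : Fin 3)) t

/-- `g` maps the words of the list `l` to the words of the list `m`, in order. -/
abbrev Maps (g : CantorGroup) (l m : List Word) : Prop := List.Forall₂ (Sends g) l m

theorem Maps.mul {g h : CantorGroup} {l m n : List Word} (hg : Maps g l m) (hh : Maps h m n) :
    Maps (g * h) l n := by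
  induction hg generalizing n with
  | nil => cases hh; exact .nil
  | cons h₁ _ ih => cases hh with | cons h₂ h₃ => exact .cons (h₁.mul h₂) (ih h₃)

theorem Maps.inv {g : CantorGroup} {l m : List Word} (hg : Maps g l m) : Maps g⁻¹ m l := by
  induction hg with
  | nil => exact .nil
  | cons h₁ _ ih => exact .cons h₁.inv ih

theorem maps_one (l : List Word) : Maps 1 l l := List.forall₂_same.2 fun u _ => sends_one u

theorem Maps.append {g : CantorGroup} {l m l' m' : List Word} (h : Maps g l m)
    (h' : Maps g l' m') : Maps g (l ++ l') (m ++ m') := List.rel_append h h'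

theorem maps_map {g : CantorGroup} {p q : Word → Word} (h : ∀ t, Sends g (p t) (q t))
    (l : List Word) : Maps g (l.map p) (l.map q) := by
  rw [Maps, List.forall₂_map_left_iff, List.forall₂_map_right_iff]
  exact List.forall₂_same.2 fun u _ => h u

theorem Maps.map {g h : CantorGroup} {l m : List Word} (H : Maps g l m) {p q : Word → Word}
    (hpq : ∀ u v, Sends g u v → Sends h (p u) (q v)) : Maps h (l.map p) (m.map q) := by
  rw [Maps, List.forall₂_map_left_iff, List.forall₂_map_right_iff]
  exact H.imp hpq

theorem Maps.sends {g : CantorGroup} {l m : List Word} (h : Maps g l m) {i : ℕ}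
    (hi : i < l.length) (hi' : i < m.length) : Sends g l[i] m[i] := by
  simpa using h.get hi hi'

theorem eq_of_sends {g h : CantorGroup} {A : PlaneTree}
    (H : ∀ u ∈ branches A, ∃ v, Sends g u v ∧ Sends h u v) : g = h := by
  refine MulOpposite.unop_injective (Homeomorph.ext fun x => ?_)
  obtain ⟨u, hu, w, rfl⟩ := exists_branch A x
  obtain ⟨v, h₁, h₂⟩ := H u hu
  rw [h₁ w, h₂ w]

theorem Maps.eq {g h : CantorGroup} {A : PlaneTree} {m : List Word}
    (hg : Maps g (branches A) m) (hh : Maps h (branches A) m) : g = h := by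
  refine eq_of_sends (A := A) fun u hu => ?_
  obtain ⟨i, hi, rfl⟩ := List.getElem_of_mem hu
  have hi' : i < m.length := hg.length_eq ▸ hi
  exact ⟨m[i], hg.sends hi hi', hh.sends hi hi'⟩

theorem branches_pos (T : PlaneTree) : 0 < (branches T).length := by
  induction T with
  | nil => simp [branches]
  | node a l r ihl ihr => simp [branches]; omega

theorem length_branches_node (a : Unit) (l r : PlaneTree) :
    (branches (.node a l r)).length = (branches l).length + (branches r).length := by
  simp [branches]

/-! ### Generation of `F` -/

/-- `k` acts on the cone of `1` as `h` acts on all words, and trivially on the cone of `0`. -/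
def IsShift (h k : CantorGroup) : Prop :=
  (∀ x, k.unop (consWord true x) = consWord true (h.unop x)) ∧
    ∀ x, k.unop (consWord false x) = consWord false x

theorem isShift_of_sends {h k : CantorGroup} (A : PlaneTree) (h0 : Sends k [false] [false])
    (H : ∀ u ∈ branches A, ∃ v, Sends h u v ∧ Sends k (true :: u) (true :: v)) :
    IsShift h k := by
  refine ⟨fun x => ?_, h0⟩
  obtain ⟨u, hu, w, rfl⟩ := exists_branch A x
  obtain ⟨v, h₁, h₂⟩ := H u hu
  rw [h₁ w]
  exact h₂ w

theorem isShift_genX0 : IsShift genX0 genX1 := by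
  refine isShift_of_sends leftTree (x1_0 []) ?_
  simp only [leftTree, branches, List.map, List.mem_cons, List.cons_append,
    List.nil_append, List.not_mem_nil, or_false]
  rintro u (rfl | rfl | rfl)
  · exact ⟨_, x0_00 _, x1_100 _⟩
  · exact ⟨_, x0_01 _, x1_101 _⟩
  · exact ⟨_, x0_1 _, x1_11 _⟩

theorem isShift_genX1 : IsShift genX1 (genX0⁻¹ * genX1 * genX0) := by
  refine isShift_of_sends (.node () .nil leftTree)
    (((x0_00 []).inv.mul (x1_0 _)).mul (x0_00 _)) ?_
  simp only [leftTree, branches, List.map, List.mem_cons, List.cons_append,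
    List.nil_append, List.not_mem_nil, or_false]
  rintro u (rfl | rfl | rfl | rfl)
  · exact ⟨_, x1_0 _, ((x0_01 _).inv.mul (x1_0 _)).mul (x0_01 _)⟩
  · exact ⟨_, x1_100 _, ((x0_1 _).inv.mul (x1_100 _)).mul (x0_1 _)⟩
  · exact ⟨_, x1_101 _, ((x0_1 _).inv.mul (x1_101 _)).mul (x0_1 _)⟩
  · exact ⟨_, x1_11 _, ((x0_1 _).inv.mul (x1_11 _)).mul (x0_1 _)⟩

theorem IsShift.mul {h k h' k' : CantorGroup} (H : IsShift h k) (H' : IsShift h' k') :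
    IsShift (h * h') (k * k') :=
  ⟨fun x => (congrArg k'.unop (H.1 x)).trans (H'.1 _),
    fun x => (congrArg k'.unop (H.2 x)).trans (H'.2 _)⟩

theorem IsShift.inv {h k : CantorGroup} (H : IsShift h k) : IsShift h⁻¹ k⁻¹ := by
  refine ⟨fun x => ?_, fun x => ?_⟩
  · change k.unop.symm _ = consWord true (h.unop.symm x)
    rw [Homeomorph.symm_apply_eq, H.1, Homeomorph.apply_symm_apply]
  · change k.unop.symm _ = _
    rw [Homeomorph.symm_apply_eq, H.2]

theorem IsShift.sends {h k : CantorGroup} (H : IsShift h k) {u v : Word} (huv : Sends h u v) :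
    Sends k (true :: u) (true :: v) := fun w => by
  rw [prepend_cons, H.1, huv w, prepend_cons]

/-- The subgroup generated by `x₀` and `x₁`. -/
noncomputable abbrev genF : Subgroup CantorGroup := Subgroup.closure {genX0, genX1}

theorem genX0_mem : genX0 ∈ genF := Subgroup.subset_closure (by simp)
theorem genX1_mem : genX1 ∈ genF := Subgroup.subset_closure (by simp)

/-- Shifting into the cone of `1` is compatible with products and inverses, so the generators
suffice: `x₀` shifts to `x₁`, and `x₁` to its conjugate by `x₀`. -/
theorem exists_isShift {h : CantorGroup} (hh : h ∈ genF) : ∃ k ∈ genF, IsShift h k := by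
  induction hh using Subgroup.closure_induction with
  | mem x hx =>
    rcases hx with rfl | rfl
    · exact ⟨_, genX1_mem, isShift_genX0⟩
    · exact ⟨_, mul_mem (mul_mem (inv_mem genX0_mem) genX1_mem) genX0_mem, isShift_genX1⟩
  | one => exact ⟨1, one_mem _, fun _ => rfl, fun _ => rfl⟩
  | mul x y _ _ hx hy =>
    obtain ⟨k, hk, hk'⟩ := hx
    obtain ⟨l, hl, hl'⟩ := hy
    exact ⟨k * l, mul_mem hk hl, hk'.mul hl'⟩
  | inv x _ hx =>
    obtain ⟨k, hk, hk'⟩ := hx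
    exact ⟨k⁻¹, inv_mem hk, hk'.inv⟩

/-- The tree with `n + 1` leaves all of whose left subtrees are leaves. -/
def comb : ℕ → PlaneTree
  | 0 => .nil
  | n + 1 => .node () .nil (comb n)

theorem length_branches_comb (n : ℕ) : (branches (comb n)).length = n + 1 := by
  induction n with
  | zero => rfl
  | succ n ih => rw [comb, length_branches_node, ih, branches, List.length_singleton, add_comm]

theorem exists_maps_comb (n : ℕ) (T : PlaneTree) (hT : (branches T).length = n + 1) :
    ∃ h ∈ genF, Maps h (branches T) (branches (comb n)) := by
  induction n generalizing T with
  | zero =>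
    cases T with
    | nil => exact ⟨1, one_mem _, maps_one _⟩
    | node a l r =>
      have := branches_pos l
      have := branches_pos r
      rw [length_branches_node] at hT
      omega
  | succ n ih =>
    cases T with
    | nil => simp [branches] at hT
    | node a l r =>
      -- The generator `x₀` is the tree rotation `((p q) r) ↦ (p (q r))`, which shrinks the left
      -- subtree. Once that subtree is a leaf, the outer hypothesis for `r`, shifted into the cone
      -- of `1`, finishes.
      induction l generalizing r with
      | nil =>
        rw [length_branches_node, branches, List.length_singleton] at hT
        obtain ⟨h, hh, hm⟩ := ih r (by omega)
        obtain ⟨k, hk, hs⟩ := exists_isShift hh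
        refine ⟨k, hk, ?_⟩
        rw [comb, branches, branches, branches]
        exact (maps_map (fun t => (Sends.append (u := [false]) (v := [false]) hs.2 t)) _).append
          (hm.map fun u v => hs.sends)
      | node a' p q ihp ihq =>
        obtain ⟨h, hh, hm⟩ := ihp (.node () q r) (by
          rw [length_branches_node, length_branches_node] at hT ⊢; omega)
        refine ⟨genX0 * h, mul_mem genX0_mem hh, Maps.mul ?_ hm⟩
        simp only [branches, List.map_append, List.map_map, List.append_assoc]
        exact (maps_map x0_00 _).append ((maps_map x0_01 _).append (maps_map x0_1 _))

theorem exists_maps_genF (A B : PlaneTree) (hAB : (branches A).length = (branches B).length) :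
    ∃ h ∈ genF, Maps h (branches A) (branches B) := by
  have := branches_pos A
  obtain ⟨h, hh, hm⟩ := exists_maps_comb ((branches A).length - 1) A (by omega)
  obtain ⟨k, hk, hn⟩ := exists_maps_comb ((branches A).length - 1) B (by omega)
  exact ⟨h * k⁻¹, mul_mem hh (inv_mem hk), hm.mul hn.inv⟩

theorem mem_genF_of_maps {g : CantorGroup} {A B : PlaneTree}
    (hg : Maps g (branches A) (branches B)) : g ∈ genF := by
  obtain ⟨h, hh, hm⟩ := exists_maps_genF A B hg.length_eq
  rwa [hg.eq hm]

/-! ### Generation of `T` -/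

/-- The subgroup generated by `x₀`, `x₁` and `c₁`. -/
noncomputable abbrev genT : Subgroup CantorGroup := Subgroup.closure {genX0, genX1, genC1}

theorem genF_le_genT : genF ≤ genT :=
  Subgroup.closure_mono (by simp [Set.insert_subset_iff])

theorem genC1_mem : genC1 ∈ genT := Subgroup.subset_closure (by simp)

/-- With `half_1`, this is the half turn of the circle. Between suitable elements of `F` it yields
every rotation of leaves. -/
theorem half_0 (t : Word) : Sends (genX0 * genC1⁻¹) (false :: t) (true :: t) := by
  refine Sends.append (u := [false]) (v := [true]) (fun w => ?_) t
  rw [← consWord_eta w]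
  cases w 0
  · exact ((x0_00 []).mul (c1_10 []).inv) _
  · exact ((x0_01 []).mul (c1_11 []).inv) _

theorem half_1 (t : Word) : Sends (genX0 * genC1⁻¹) (true :: t) (false :: t) :=
  (x0_1 t).mul (c1_0 t).inv

theorem exists_maps_genT (A B : PlaneTree) (hAB : (branches A).length = (branches B).length)
    {l : List Word} (hl : l ~r branches A) : ∃ h ∈ genT, Maps h l (branches B) := by
  obtain ⟨k, rfl⟩ := hl.symm
  rw [List.rotate_eq_drop_append_take_mod]
  have hA := branches_pos A
  have hk := Nat.mod_lt k hA
  generalize k % (branches A).length = i at hk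
  rcases Nat.eq_zero_or_pos i with rfl | hi
  · obtain ⟨h, hh, hm⟩ := exists_maps_genF A B hAB
    exact ⟨h, genF_le_genT hh, by simpa using hm⟩
  -- The tree `comb n` has `n + 1` leaves, so the left half receives exactly the first `i` leaves
  -- and the right half the others. The half turn then exchanges the two blocks.
  have h₁ := length_branches_comb (i - 1)
  have h₂ := length_branches_comb ((branches A).length - i - 1)
  obtain ⟨f, hf, hm⟩ := exists_maps_genF A
    (.node () (comb (i - 1)) (comb ((branches A).length - i - 1)))
    (by rw [length_branches_node]; omega)
  obtain ⟨h, hh, hn⟩ := exists_maps_genF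
    (.node () (comb ((branches A).length - i - 1)) (comb (i - 1))) B
    (by rw [length_branches_node]; omega)
  refine ⟨f * (genX0 * genC1⁻¹) * h, mul_mem (mul_mem (genF_le_genT hf)
    (mul_mem (genF_le_genT genX0_mem) (inv_mem genC1_mem))) (genF_le_genT hh), Maps.mul ?_ hn⟩
  have h₃ := List.forall₂_take i hm
  have h₄ := List.forall₂_drop i hm
  have h₅ : ((branches (comb (i - 1))).map (List.cons false)).length = i := by
    rw [List.length_map]; omega
  rw [branches, List.take_left' h₅] at h₃
  rw [branches, List.drop_left' h₅] at h₄
  exact (Maps.mul h₄ (maps_map half_1 _)).append (Maps.mul h₃ (maps_map half_0 _))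

theorem mem_genT_of_maps {g : CantorGroup} {A B : PlaneTree} {l : List Word}
    (hg : Maps g (branches A) l) (hl : l ~r branches B) : g ∈ genT := by
  obtain ⟨h, hh, hm⟩ := exists_maps_genT B B rfl hl
  have := genF_le_genT (mem_genF_of_maps (hg.mul hm))
  simpa using mul_mem this (inv_mem hh)

/-! ### Generation of `V` -/

/-- The subgroup generated by `x₀`, `x₁`, `c₁` and `π₀`. -/
noncomputable abbrev genV : Subgroup CantorGroup :=
  Subgroup.closure {genX0, genX1, genC1, genPi0}

theorem genT_le_genV : genT ≤ genV :=
  Subgroup.closure_mono (by simp [Set.insert_subset_iff])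

theorem genPi0_mem : genPi0 ∈ genV := Subgroup.subset_closure (by simp)

theorem submonoid_perm_eq_top {m : ℕ} (S : Submonoid (Equiv.Perm (Fin m)))
    (hS : ∀ i j : Fin m, (j : ℕ) = i + 1 → Equiv.swap i j ∈ S) : S = ⊤ := by
  cases m with
  | zero => exact Subsingleton.elim _ _
  | succ n =>
    rw [eq_top_iff, ← Equiv.Perm.mclosure_swap_castSucc_succ, Submonoid.closure_le]
    rintro _ ⟨i, rfl⟩
    exact hS _ _ (by simp)

/-- The permutations of the leaves of a tree that are induced by elements of `genV`. -/
def leafPerms (B : PlaneTree) : Submonoid (Equiv.Perm (Fin (branches B).length)) where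
  carrier := {σ | ∃ h ∈ genV, ∀ i, Sends h ((branches B).get i) ((branches B).get (σ i))}
  one_mem' := ⟨1, one_mem _, fun _ => sends_one _⟩
  mul_mem' := by
    rintro σ τ ⟨h, hh, hσ⟩ ⟨k, hk, hτ⟩
    -- The permutation `σ * τ` applies `τ` first, whereas products in the group are read from left
    -- to right.
    exact ⟨k * h, mul_mem hk hh, fun i => (hτ i).mul (hσ _)⟩

theorem exists_mem_sends {g : CantorGroup} {l m : List Word} (h : Maps g l m) {u : Word}
    (hu : u ∈ l) : ∃ v ∈ m, Sends g u v := by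
  obtain ⟨i, hi, rfl⟩ := List.getElem_of_mem hu
  have hi' : i < m.length := h.length_eq ▸ hi
  exact ⟨_, List.getElem_mem hi', h.sends hi hi'⟩

/-- An element of `T` moves the two neighbouring leaves to `0` and `10`, and all others below `11`.
Conjugating `π₀` by it gives the transposition. -/
theorem swap_mem_leafPerms (B : PlaneTree) (i j : Fin (branches B).length)
    (hij : (j : ℕ) = i + 1) : Equiv.swap i j ∈ leafPerms B := by
  have hj := j.2
  obtain hm | hm : (branches B).length = 2 ∨ 3 ≤ (branches B).length := by omega
  -- With two leaves there is no room for the cone of `11`, but the transposition is itself a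
  -- rotation.
  · obtain ⟨t, ht, hB⟩ := exists_maps_genT B B rfl (l := (branches B).rotate 1) ⟨1, by
      rw [List.rotate_rotate, show 1 + 1 = (branches B).length from hm.symm,
        List.rotate_length]⟩
    have h₀ := hB.sends (i := 0) (by simp; omega) (by omega)
    have h₁ := hB.sends (i := 1) (by simp; omega) (by omega)
    simp only [List.getElem_rotate, hm] at h₀ h₁
    have hi0 : i = ⟨0, by omega⟩ := Fin.ext (by simp; omega)
    have hj1 : j = ⟨1, by omega⟩ := Fin.ext (by simp; omega)
    refine ⟨t, genT_le_genV ht, fun p => ?_⟩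
    obtain rfl | rfl : p = i ∨ p = j := by
      rw [hi0, hj1, Fin.ext_iff, Fin.ext_iff]
      have := p.2
      simp only
      omega
    · rw [Equiv.swap_apply_left, hi0, hj1]; exact h₁
    · rw [Equiv.swap_apply_right, hi0, hj1]; exact h₀
  · obtain ⟨t, ht, hB⟩ := exists_maps_genT B
      (.node () .nil (.node () .nil (comb ((branches B).length - 3))))
      (by rw [length_branches_node, length_branches_node, length_branches_comb, branches,
            List.length_singleton]; omega) (l := (branches B).rotate i) (List.IsRotated.symm ⟨i, rfl⟩)
    have h₀ := hB.sends (i := 0) (by simp; omega) (by simp [branches])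
    have h₁ := hB.sends (i := 1) (by simp; omega) (by simp [branches])
    simp only [List.getElem_rotate, branches, List.map_cons, List.map_nil, List.cons_append,
      List.nil_append, List.getElem_cons_zero, List.getElem_cons_succ,
      Nat.zero_add, Nat.add_comm 1, ← hij, Nat.mod_eq_of_lt hj, Nat.mod_eq_of_lt i.2] at h₀ h₁
    refine ⟨t * genPi0 * t⁻¹, mul_mem (mul_mem (genT_le_genV ht) genPi0_mem)
      (inv_mem (genT_le_genV ht)), fun p => ?_⟩
    obtain ⟨v, hv, hs⟩ := exists_mem_sends hB (u := (branches B).get p)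
      (by rw [List.mem_rotate]; exact List.get_mem _ _)
    simp only [branches, List.map_cons, List.map_nil, List.cons_append,
      List.nil_append, List.map_map, List.mem_cons, List.mem_map] at hv
    have hinj := (branches_nodup B).injective_get
    rcases hv with rfl | rfl | ⟨v, -, rfl⟩
    · rw [hinj (hs.source_unique h₀ : _ = (branches B).get i), Equiv.swap_apply_left]
      exact (Sends.mul h₀ (pi0_0 _)).mul h₁.inv
    · rw [hinj (hs.source_unique h₁ : _ = (branches B).get j), Equiv.swap_apply_right]
      exact (Sends.mul h₁ (pi0_10 _)).mul h₀.inv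
    · rw [Equiv.swap_apply_of_ne_of_ne]
      · exact (hs.mul (pi0_11 _)).mul hs.inv
      · rintro rfl
        have := Takes.unique hs h₀
        simp at this
      · rintro rfl
        have := Takes.unique hs h₁
        simp at this

/-- Composing with an element of `F` from the range tree to the domain tree leaves a pure
permutation of the leaves of one tree, a product of adjacent transpositions. -/
theorem mem_genV_of_diagram (D : TreeDiagram) : D.toGroup ∈ genV := by
  obtain ⟨f, hf, hm⟩ := exists_maps_genF D.ran D.dom D.length_eq.symm
  have hσ : (finCongr D.length_eq.symm).trans D.perm ∈ leafPerms D.ran :=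
    submonoid_perm_eq_top _ (swap_mem_leafPerms D.ran) ▸ trivial
  obtain ⟨h, hh, hs⟩ := hσ
  have key : f * D.toGroup = h := by
    refine eq_of_sends (A := D.ran) fun u hu => ?_
    obtain ⟨i, rfl⟩ := List.get_of_mem hu
    exact ⟨_, Sends.mul (hm.sends i.2 (D.length_eq.symm ▸ i.2))
      (D.takes (finCongr D.length_eq.symm i)), hs i⟩
  rw [← inv_mul_cancel_left f D.toGroup, key]
  exact mul_mem (inv_mem (genT_le_genV (genF_le_genT hf))) hh

theorem toGroup_mem_closure {K : Kind} {D : TreeDiagram} (hD : D.HasKind K) :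
    D.toGroup ∈ Subgroup.closure (TreeDiagram.toGroup '' generatorDiagrams K) := by
  have hm : K.Rel ((branches D.dom).map (target D.toHomeo)) (branches D.ran) := hD.rep.2
  have hs : Maps D.toGroup (branches D.dom) ((branches D.dom).map (target D.toHomeo)) := by
    rw [Maps, List.forall₂_map_right_iff]
    exact List.forall₂_same.2 hD.rep.1
  cases K with
  | F =>
    rw [generatorDiagrams, Set.image_pair]
    exact mem_genF_of_maps ((hm : _ = _) ▸ hs)
  | T =>
    rw [generatorDiagrams, Set.image_insert_eq, Set.image_pair]
    exact mem_genT_of_maps hs hm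
  | V =>
    rw [generatorDiagrams, Set.image_insert_eq, Set.image_insert_eq, Set.image_pair]
    exact mem_genV_of_diagram D

/-- Word length is an infimum in `ℕ`, which is `0` for the empty set. Generation ensures that it is
attained by a word. -/
theorem closure_generators (K : Kind) : Subgroup.closure (generators K) = ⊤ := by
  rw [eq_top_iff]
  rintro ⟨_, D, hD, rfl⟩ -
  have h := toGroup_mem_closure hD
  have himage : TreeDiagram.toGroup '' generatorDiagrams K =
      (thompson K).subtype '' generators K := by
    ext g
    constructor
    · rintro ⟨E, hE, rfl⟩
      exact ⟨⟨_, generatorDiagrams_mem K hE⟩, ⟨E, hE, rfl⟩, rfl⟩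
    · rintro ⟨_, ⟨E, hE, h⟩, rfl⟩
      exact ⟨E, hE, h⟩
  rw [himage, ← MonoidHom.map_closure] at h
  obtain ⟨g, hg, hgD⟩ := h
  have hg' : g = ⟨D.toGroup, D, hD, rfl⟩ := Subtype.ext hgD
  rwa [hg'] at hg

/-! ### Word length and walks in Cayley graphs -/

section WordLength

variable {G : Type*} [Group G] {X : Set G}

theorem wordLength_le {w : List G} (hw : ∀ a ∈ w, a ∈ X ∨ a⁻¹ ∈ X) :
    wordLength X w.prod ≤ w.length :=
  Nat.sInf_le ⟨w, rfl, hw, rfl⟩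

theorem exists_word (hX : Subgroup.closure X = ⊤) (g : G) :
    ∃ w : List G, w.length = wordLength X g ∧ (∀ a ∈ w, a ∈ X ∨ a⁻¹ ∈ X) ∧ w.prod = g := by
  have hg : g ∈ Subgroup.closure X := hX ▸ trivial
  rw [← Subgroup.mem_toSubmonoid, Subgroup.closure_toSubmonoid] at hg
  obtain ⟨w, h₁, h₂⟩ := Submonoid.exists_list_of_mem_closure hg
  have hne : {n | ∃ w : List G, w.length = n ∧ (∀ a ∈ w, a ∈ X ∨ a⁻¹ ∈ X) ∧ w.prod = g}.Nonempty :=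
    ⟨_, w, rfl, h₁, h₂⟩
  exact Nat.sInf_mem hne

theorem wordLength_one : wordLength X (1 : G) = 0 :=
  Nat.le_zero.1 (wordLength_le (w := []) (by simp))

theorem wordLength_letter_le {a : G} (ha : a ∈ X ∨ a⁻¹ ∈ X) : wordLength X a ≤ 1 := by
  simpa using wordLength_le (w := [a]) (by simpa using ha)

theorem wordLength_mul_le (hX : Subgroup.closure X = ⊤) (g h : G) :
    wordLength X (g * h) ≤ wordLength X g + wordLength X h := by
  obtain ⟨v, hv, hv', rfl⟩ := exists_word hX g
  obtain ⟨w, hw, hw', rfl⟩ := exists_word hX h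
  rw [← hv, ← hw, ← List.prod_append, ← List.length_append]
  refine wordLength_le fun a ha => ?_
  rcases List.mem_append.1 ha with ha | ha
  exacts [hv' a ha, hw' a ha]

theorem wordLength_inv_le (hX : Subgroup.closure X = ⊤) (g : G) :
    wordLength X g⁻¹ ≤ wordLength X g := by
  obtain ⟨w, hw, hw', rfl⟩ := exists_word hX g
  rw [← hw, List.prod_inv_reverse]
  refine (wordLength_le fun a ha => ?_).trans (by simp)
  simp only [List.mem_reverse, List.mem_map] at ha
  obtain ⟨b, hb, rfl⟩ := ha
  rw [inv_inv]
  exact (hw' b hb).symm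

theorem wordLength_inv (hX : Subgroup.closure X = ⊤) (g : G) :
    wordLength X g⁻¹ = wordLength X g :=
  (wordLength_inv_le hX g).antisymm (by simpa using wordLength_inv_le hX g⁻¹)

theorem wordLength_le_mul (hX : Subgroup.closure X = ⊤) (g h : G) :
    wordLength X g ≤ wordLength X (g * h) + wordLength X h := by
  simpa [wordLength_inv hX] using wordLength_mul_le hX (g * h) h⁻¹

theorem wordLength_pow_le (hX : Subgroup.closure X = ⊤) (g : G) (n : ℕ) :
    wordLength X (g ^ n) ≤ n * wordLength X g := by
  induction n with
  | zero => simp [wordLength_one]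
  | succ n ih =>
    rw [pow_succ, Nat.succ_mul]
    exact (wordLength_mul_le hX _ _).trans (Nat.add_le_add_right ih _)

variable (X) in
/-- There is a walk from `g` to `h` of length at most `l` through vertices that satisfy `P`. -/
def Reach (P : G → Prop) (l : ℕ) (g h : G) : Prop :=
  ∃ p : (SimpleGraph.mulCayley X).Walk g h, p.length ≤ l ∧ ∀ v ∈ p.support, P v

variable {P : G → Prop} {l l' : ℕ} {g h k : G}

theorem Reach.refl (hg : P g) : Reach X P 0 g g := ⟨.nil, by simp, by simpa using hg⟩

theorem Reach.symm (H : Reach X P l g h) : Reach X P l h g := by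
  obtain ⟨p, h₁, h₂⟩ := H
  exact ⟨p.reverse, by simpa using h₁, by simpa using h₂⟩

theorem Reach.trans (H : Reach X P l g h) (H' : Reach X P l' h k) : Reach X P (l + l') g k := by
  obtain ⟨p, h₁, h₂⟩ := H
  obtain ⟨q, h₃, h₄⟩ := H'
  refine ⟨p.append q, by rw [SimpleGraph.Walk.length_append]; omega, fun v hv => ?_⟩
  rw [SimpleGraph.Walk.mem_support_append_iff] at hv
  exact hv.elim (h₂ v) (h₄ v)

theorem Reach.refl_right (H : Reach X P l g h) : Reach X P l' h h := by
  obtain ⟨p, -, h₂⟩ := H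
  exact ⟨.nil, by simp, by simpa using h₂ h p.end_mem_support⟩

theorem Reach.mono (H : Reach X P l g h) (hl : l ≤ l') : Reach X P l' g h := by
  obtain ⟨p, h₁, h₂⟩ := H
  exact ⟨p, h₁.trans hl, h₂⟩

theorem Reach.step {a : G} (ha : a ∈ X ∨ a⁻¹ ∈ X) (hg : P g) (hga : P (g * a)) :
    Reach X P 1 g (g * a) := by
  by_cases hne : g = g * a
  · rw [← hne]
    exact (Reach.refl hg).mono (Nat.zero_le _)
  · have hadj : (SimpleGraph.mulCayley X).Adj g (g * a) := by
      rw [SimpleGraph.mulCayley_adj']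
      refine ⟨hne, ?_⟩
      rcases ha with ha | ha
      · exact ⟨a, ha, Or.inl rfl⟩
      · exact ⟨a⁻¹, ha, Or.inr (by simp)⟩
    refine ⟨hadj.toWalk, by simp, fun v hv => ?_⟩
    simp only [SimpleGraph.Walk.support_cons, SimpleGraph.Walk.support_nil, List.mem_cons,
      List.not_mem_nil, or_false] at hv
    rcases hv with rfl | rfl
    exacts [hg, hga]

theorem Reach.of_word {w : List G} (hw : ∀ a ∈ w, a ∈ X ∨ a⁻¹ ∈ X)
    (hP : ∀ v, v <+: w → P (g * v.prod)) : Reach X P w.length g (g * w.prod) := by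
  induction w using List.reverseRecOn with
  | nil => simpa using Reach.refl (by simpa using hP [] List.nil_prefix)
  | append_singleton w a ih =>
    rw [List.length_append, List.prod_append, List.prod_singleton, ← mul_assoc]
    refine (ih (fun b hb => hw b (by simp [hb])) fun v hv =>
      hP v (hv.trans (List.prefix_append _ _))).trans (Reach.step (hw a (by simp)) ?_ ?_)
    · exact hP w (List.prefix_append _ _)
    · simpa [mul_assoc] using hP (w ++ [a]) List.prefix_rfl

/-- Along a geodesic word for `s` the length drops by at most `|s|`, so only vertices that satisfy
this bound are met. -/
theorem Reach.of_far (hX : Subgroup.closure X = ⊤) {s : G}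
    (hP : ∀ v, wordLength X g ≤ wordLength X v + wordLength X s → P v) :
    Reach X P (wordLength X s) g (g * s) := by
  obtain ⟨w, hw, hw', rfl⟩ := exists_word hX s
  rw [← hw]
  refine Reach.of_word hw' fun v hv => hP _ ?_
  obtain ⟨t, rfl⟩ := hv
  have h₁ := wordLength_le_mul hX g v.prod
  have h₂ : wordLength X v.prod ≤ v.length :=
    wordLength_le fun a ha => hw' a (List.mem_append_left _ ha)
  rw [← hw, List.length_append]
  omega

theorem Reach.pow {y : G} {n : ℕ} (h0 : P g)
    (H : ∀ j < n, Reach X P l (g * y ^ j) (g * y ^ (j + 1))) :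
    Reach X P (n * l) g (g * y ^ n) := by
  induction n with
  | zero => simpa using Reach.refl h0
  | succ n ih =>
    rw [Nat.succ_mul]
    exact (ih fun j hj => H j (by omega)).trans (H n (by omega))

end WordLength

/-! ### A lower bound for the word length -/

/-- The words whose cones `g` does not send onto a cone by exchange of prefixes. -/
def badWords (g : CantorGroup) : Set Word := {u | ∀ v, ¬ Sends g u v}

theorem mem_badWords_of_append {g : CantorGroup} {u t : Word} (h : u ++ t ∈ badWords g) :
    u ∈ badWords g := fun _ hv => h _ (hv.append t)

/-- Any extension of a branch of the domain tree is sent by prefix exchange, so bad words are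
prefixes of branches. Finiteness matters because `ncard` is `0` on infinite sets. -/
theorem finite_badWords {K : Kind} {g : CantorGroup} (hg : g ∈ thompson K) :
    (badWords g).Finite := by
  obtain ⟨D, -, rfl⟩ := hg
  refine ((List.finite_toSet ((branches D.dom).flatMap List.inits))).subset fun u hu => ?_
  obtain ⟨b, hb, w, hw⟩ := exists_branch D.dom (prepend u fun _ => false)
  obtain ⟨i, rfl⟩ := List.get_of_mem hb
  rcases le_total ((branches D.dom).get i).length u.length with h | h
  · obtain ⟨t, rfl, -⟩ := prepend_prefix hw h
    exact absurd (Sends.append (D.takes i) t) (hu _)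
  · obtain ⟨t, ht, -⟩ := prepend_prefix hw.symm h
    simp only [List.mem_flatMap, Set.mem_ofPred_eq, List.mem_inits]
    exact ⟨_, hb, t, ht.symm⟩

/-- A word bad for `g * h` is bad for `g`, or else `g` sends it to a word bad for `h`; in the second
case it is recovered as the target under `g⁻¹`. -/
theorem ncard_badWords_mul_le {K : Kind} {g h : CantorGroup} (hg : g ∈ thompson K)
    (hh : h ∈ thompson K) :
    (badWords (g * h)).ncard ≤ (badWords g).ncard + (badWords h).ncard := by
  have hsub : badWords (g * h) ⊆ badWords g ∪ target g⁻¹.unop '' badWords h := by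
    intro u hu
    by_cases hug : u ∈ badWords g
    · exact Or.inl hug
    · simp only [badWords, Set.mem_ofPred_eq, not_forall, not_not] at hug
      obtain ⟨v, hv⟩ := hug
      exact Or.inr ⟨v, fun w hw => hu w (hv.mul hw), Takes.target_eq hv.inv⟩
  refine (Set.ncard_le_ncard hsub ((finite_badWords hg).union
    ((finite_badWords hh).image _))).trans ((Set.ncard_union_le _ _).trans ?_)
  exact Nat.add_le_add_left (Set.ncard_image_le (finite_badWords hh)) _

theorem badWords_one : badWords 1 = ∅ :=
  Set.eq_empty_of_forall_notMem fun u hu => hu u (sends_one u)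

theorem finite_generators (K : Kind) : (generators K).Finite := by
  have : (generatorDiagrams K).Finite := by
    cases K <;> simp [generatorDiagrams]
  exact ((this.image TreeDiagram.toGroup).preimage Subtype.val_injective.injOn).subset
    fun g hg => hg

theorem exists_ncard_badWords_le (K : Kind) : ∃ C : ℕ, ∀ z : thompson K,
    (badWords z).ncard ≤ C * wordLength (generators K) z := by
  -- The constant bounds the number of bad words of all generators and their inverses.
  obtain ⟨C, hC⟩ := (((finite_generators K).union (finite_generators K).inv).image
    fun z : thompson K => (badWords z).ncard).bddAbove
  refine ⟨C, fun z => ?_⟩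
  obtain ⟨w, hw, hw', rfl⟩ := exists_word (closure_generators K) z
  rw [← hw]
  clear hw
  induction w with
  | nil => simp [badWords_one]
  | cons a w ih =>
    rw [List.prod_cons, List.length_cons, Nat.mul_succ, Nat.add_comm]
    refine (ncard_badWords_mul_le a.2 (w.prod : thompson K).2).trans (Nat.add_le_add ?_ ?_)
    · exact hC ⟨a, hw' a (by simp), rfl⟩
    · exact ih fun b hb => hw' b (by simp [hb])

/-- If the prefixes of lengths less than `n` of a word of the form `u bbb…` are bad, there are at
least `n` bad words. -/
theorem le_ncard_badWords {K : Kind} {g : CantorGroup} (hg : g ∈ thompson K) (u : Word) (b : Bool)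
    {n : ℕ} (h : ∀ m < n, u ++ List.replicate m b ∈ badWords g) : n ≤ (badWords g).ncard := by
  have := Set.ncard_le_ncard (s := (fun m => u ++ List.replicate m b) '' Set.Iio n)
    (t := badWords g) (by rintro _ ⟨m, hm, rfl⟩; exact h m hm) (finite_badWords hg)
  rwa [Set.ncard_image_of_injective _ (fun m m' hm => by
    simpa using congrArg List.length hm), Set.ncard_Iio_nat] at this

/-! ### Copies of `x₀` in a cone -/

/-- `g` maps the cone of `u` onto the cone of `v` in the way `a` acts on all words. -/
def ActsBy (g : CantorGroup) (u v : Word) (a : CantorGroup) : Prop :=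
  ∀ x, g.unop (prepend u x) = prepend v (a.unop x)

theorem Sends.actsBy {g : CantorGroup} {u v : Word} (h : Sends g u v) : ActsBy g u v 1 := h

theorem ActsBy.mul {g h a b : CantorGroup} {u v w : Word} (hg : ActsBy g u v a)
    (hh : ActsBy h v w b) : ActsBy (g * h) u w (a * b) :=
  fun x => (congrArg h.unop (hg x)).trans (hh _)

theorem ActsBy.pow {g a : CantorGroup} {u : Word} (hg : ActsBy g u u a) (n : ℕ) :
    ActsBy (g ^ n) u u (a ^ n) := by
  induction n with
  | zero => exact fun _ => rfl
  | succ n ih => rw [pow_succ, pow_succ]; exact ih.mul hg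

theorem Sends.pow {g : CantorGroup} {u : Word} (h : Sends g u u) (n : ℕ) : Sends (g ^ n) u u := by
  have := h.actsBy.pow n
  rwa [one_pow] at this

theorem x0_pow (n : ℕ) (t : Word) :
    Sends (genX0 ^ n) (List.replicate n false ++ false :: t) (false :: t) := by
  induction n with
  | zero => exact sends_one _
  | succ n ih =>
    rw [pow_succ', List.replicate_succ, List.cons_append]
    refine Sends.mul ?_ ih
    cases n <;> exact x0_00 _

/-- The map `x₀ ^ n` contracts `0ⁿ0` to `0`. If `u 0ᵐ` went to `v'` by prefix exchange, this would
force `v = v' 0ᵏ⁺¹`; but then `u 0ᵐ 1…` would go to `v' 1…`, outside the cone of `v`. -/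
theorem mem_badWords_of_actsBy {z : CantorGroup} {u v : Word} {n m : ℕ}
    (h : ActsBy z u v (genX0 ^ n)) (hm : m < n) : u ++ List.replicate m false ∈ badWords z := by
  intro v' hv'
  obtain ⟨k, rfl⟩ := Nat.exists_eq_add_of_lt hm
  have h₁ : v' ++ List.replicate (k + 1) false = v := by
    have : v' ++ List.replicate (k + 1) false ++ [false] = v ++ [false] := by
      refine Takes.unique (g := z.unop)
        (u := u ++ (List.replicate m false ++ List.replicate (k + 1) false ++ [false])) ?_ ?_
      · have := hv'.append (List.replicate (k + 1) false ++ [false])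
        simpa only [Sends, List.append_assoc] using this
      · intro w
        rw [prepend_append, h, prepend_append, ← List.replicate_add]
        have := x0_pow (m + k + 1) [] w
        rw [prepend_append] at this
        exact (congrArg (prepend v) this).trans (prepend_append _ _ _).symm
    exact List.append_cancel_right this
  have h₂ := hv' (consWord true fun _ => false)
  have h₃ := h (prepend (List.replicate m false) (consWord true fun _ => false))
  rw [prepend_append, h₃, ← h₁, prepend_append] at h₂
  have h₄ := prepend_injective _ h₂
  rw [List.replicate_succ, prepend_cons] at h₄
  exact absurd (consWord_inj h₄).1 (by decide)

theorem ActsBy.le_ncard {K : Kind} {z : CantorGroup} (hz : z ∈ thompson K) {u v : Word} {n : ℕ}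
    (h : ActsBy z u v (genX0 ^ n)) : n ≤ (badWords z).ncard :=
  le_ncard_badWords hz u false fun _ hm => mem_badWords_of_actsBy h hm

theorem x0_mem (K : Kind) : genX0 ∈ thompson K :=
  generatorDiagrams_mem K (by cases K <;> simp [generatorDiagrams])

theorem x1_mem (K : Kind) : genX1 ∈ thompson K :=
  generatorDiagrams_mem K (by cases K <;> simp [generatorDiagrams])

section

variable (K : Kind)

/-- The generator `x₀` of `thompson K`. -/
noncomputable def tx0 : thompson K := ⟨genX0, x0_mem K⟩

/-- The generator `x₁` of `thompson K`. -/
noncomputable def tx1 : thompson K := ⟨genX1, x1_mem K⟩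

theorem tx0_mem : tx0 K ∈ generators K :=
  ⟨diagramX0, by cases K <;> simp [generatorDiagrams], rfl⟩

theorem tx1_mem : tx1 K ∈ generators K :=
  ⟨diagramX1, by cases K <;> simp [generatorDiagrams], rfl⟩

/-- The power `x₀^{±1}` that expands the cone of the letter `b`. -/
noncomputable def expand : Bool → thompson K
  | true => (tx0 K)⁻¹
  | false => tx0 K

/-- The copy of `x₀` that acts on the cone of the letter `b`. -/
noncomputable def copyX0 : Bool → thompson K
  | true => tx1 K
  | false => tx0 K * tx0 K * (tx1 K)⁻¹ * (tx0 K)⁻¹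

end

variable {K : Kind}

theorem expand_letter (b : Bool) : expand K b ∈ generators K ∨ (expand K b)⁻¹ ∈ generators K := by
  cases b
  · exact Or.inl (tx0_mem K)
  · exact Or.inr (by simpa [expand] using tx0_mem K)

theorem expand_self (b : Bool) (t : Word) : Sends (expand K b) (b :: b :: t) (b :: t) := by
  cases b
  · exact x0_00 t
  · exact (x0_1 t).inv

theorem expand_not (b : Bool) (t : Word) :
    Sends (expand K b) ((!b) :: t) ((!b) :: (!b) :: t) := by
  cases b
  · exact x0_1 t
  · exact (x0_00 t).inv

theorem expand_pow_self (b : Bool) (n : ℕ) (t : Word) :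
    Sends (expand K b ^ n : thompson K) (List.replicate n b ++ b :: t) (b :: t) := by
  induction n with
  | zero => exact sends_one _
  | succ n ih =>
    rw [pow_succ', List.replicate_succ, List.cons_append]
    refine Sends.mul (v := List.replicate n b ++ b :: t) ?_ ih
    cases n <;> exact expand_self _ _

theorem expand_pow_not (b : Bool) (n : ℕ) (t : Word) :
    Sends (expand K b ^ n : thompson K) ((!b) :: t) (List.replicate n (!b) ++ (!b) :: t) := by
  induction n with
  | zero => exact sends_one _
  | succ n ih =>
    rw [pow_succ, List.replicate_succ, List.cons_append]
    refine Sends.mul ih ?_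
    cases n <;> exact expand_not _ _

theorem copyX0_not (b : Bool) (t : Word) : Sends (copyX0 K b) ((!b) :: t) ((!b) :: t) := by
  cases b
  · exact (((x0_1 _).mul (x0_1 _)).mul (x1_11 _).inv).mul (x0_1 t).inv
  · exact x1_0 t

theorem copyX0_actsBy (b : Bool) : ActsBy (copyX0 K b) [b] [b] genX0 := by
  cases b
  · intro x
    have hA : ∀ u ∈ branches leftTree, ∃ v, Sends genX0 u v ∧
        Sends (copyX0 K false) (false :: u) (false :: v) := by
      simp only [leftTree, branches, List.map, List.mem_cons, List.cons_append,
        List.nil_append, List.not_mem_nil, or_false]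
      rintro u (rfl | rfl | rfl)
      · exact ⟨_, x0_00 _, (((x0_00 _).mul (x0_00 _)).mul (x1_0 _).inv).mul (x0_00 _).inv⟩
      · exact ⟨_, x0_01 _, (((x0_00 _).mul (x0_01 _)).mul (x1_100 _).inv).mul (x0_01 _).inv⟩
      · exact ⟨_, x0_1 _, (((x0_01 _).mul (x0_1 _)).mul (x1_101 _).inv).mul (x0_01 _).inv⟩
    obtain ⟨u, hu, w, rfl⟩ := exists_branch leftTree x
    obtain ⟨v, h₁, h₂⟩ := hA u hu
    rw [h₁ w]
    exact h₂ w
  · exact isShift_genX0.1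

theorem wordLength_copyX0_le (b : Bool) : wordLength (generators K) (copyX0 K b) ≤ 4 := by
  have h0 : tx0 K ∈ generators K ∨ (tx0 K)⁻¹ ∈ generators K := Or.inl (tx0_mem K)
  have h1 : tx1 K ∈ generators K ∨ (tx1 K)⁻¹ ∈ generators K := Or.inl (tx1_mem K)
  have hi : ∀ a : thompson K, (a ∈ generators K ∨ a⁻¹ ∈ generators K) →
      a⁻¹ ∈ generators K ∨ a⁻¹⁻¹ ∈ generators K := fun a ha => by
    rw [inv_inv]; exact ha.symm
  cases b
  · have := wordLength_le (X := generators K) (w := [tx0 K, tx0 K, (tx1 K)⁻¹, (tx0 K)⁻¹]) (by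
      simp only [List.mem_cons, List.not_mem_nil, or_false]
      rintro a (rfl | rfl | rfl | rfl)
      exacts [h0, h0, hi _ h1, hi _ h0])
    simpa [copyX0, mul_assoc] using this
  · exact (wordLength_letter_le h1).trans (by norm_num)

/-- The letters of `copyX0` are chosen so that every intermediate vertex is `z` or `z * copyX0 K b`
followed by at most two copies of `expand K b`. Bad words can be traced through such products. -/
theorem reach_copyX0 {P : thompson K → Prop} {b : Bool} {z : thompson K} (h0 : P z)
    (h1 : P (z * expand K b)) (h2 : P (z * expand K b ^ 2))
    (h3 : P (z * copyX0 K b * expand K b)) (h4 : P (z * copyX0 K b)) :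
    Reach (generators K) P 4 z (z * copyX0 K b) := by
  cases b
  · have e1 : P (z * tx0 K * tx0 K) := by rw [mul_assoc, ← pow_two]; exact h2
    have e2 : P (z * tx0 K * tx0 K * (tx1 K)⁻¹) := by
      have : z * copyX0 K false * expand K false = z * tx0 K * tx0 K * (tx1 K)⁻¹ := by
        simp only [copyX0, expand]; group
      rwa [this] at h3
    have e3 : z * copyX0 K false = z * tx0 K * tx0 K * (tx1 K)⁻¹ * (tx0 K)⁻¹ := by
      simp only [copyX0]; group
    rw [e3] at h4 ⊢
    exact (((Reach.step (Or.inl (tx0_mem K)) h0 h1).trans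
      (Reach.step (Or.inl (tx0_mem K)) h1 e1)).trans
      (Reach.step (Or.inr (by simpa using tx1_mem K)) e1 e2)).trans
      (Reach.step (Or.inr (by simpa using tx0_mem K)) e2 h4)
  · exact (Reach.step (Or.inl (tx1_mem K)) h0 h4).mono (by norm_num)

variable {K : Kind} {C : ℕ}

/-- The word length with respect to the standard generators. -/
noncomputable abbrev wlen (z : thompson K) : ℕ := wordLength (generators K) z

theorem copyX0_pow_not (b : Bool) (j : ℕ) (t : Word) :
    Sends (copyX0 K b ^ j : thompson K) ((!b) :: t) ((!b) :: t) :=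
  Sends.pow (copyX0_not b t) j

theorem copyX0_pow_actsBy (b : Bool) (j : ℕ) :
    ActsBy (copyX0 K b ^ j : thompson K) [b] [b] (genX0 ^ j) :=
  (copyX0_actsBy b).pow j

/-! ### Leaving an element through a cone -/

/-- A word is bad for `z⁻¹` when its cone is not the prefix-exchange image of a cone under `z`.
Right multiplication by `s` carries this obstruction along. -/
theorem mem_badWords_of_sends {z s : CantorGroup} {u v : Word} (hs : Sends s u v)
    (hu : u ∈ badWords z⁻¹) : v ∈ badWords (z * s)⁻¹ := fun w hw => hu w <| by
  have := hs.mul hw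
  rwa [mul_inv_rev, mul_inv_cancel_left] at this

theorem exists_expand {g : thompson K} {b : Bool} (hb : [!b] ∈ badWords (g : CantorGroup)⁻¹) :
    ∃ k u, Sends (g * expand K b ^ k : thompson K) u [b] ∧
      ∀ m ≤ k, List.replicate m b ∈ badWords (g : CantorGroup)⁻¹ := by
  classical
  have hfin : ∃ m, List.replicate m b ∉ badWords (g : CantorGroup)⁻¹ := by
    by_contra! h
    have := le_ncard_badWords (inv_mem g.2) [] b
      (n := (badWords (g : CantorGroup)⁻¹).ncard + 1) fun m _ => by simpa using h m
    omega
  -- The empty word is bad, being a prefix of the bad word `[!b]`. So the first good power of `b` is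
  -- `k + 1`, and `k` expansions bring its cone onto that of `b`.
  have h0 : Nat.find hfin ≠ 0 := fun h => by
    have := Nat.find_spec hfin
    rw [h] at this
    exact this (mem_badWords_of_append (t := [!b]) hb)
  obtain ⟨k, hk⟩ := Nat.exists_eq_succ_of_ne_zero h0
  have hspec := Nat.find_spec hfin
  rw [hk] at hspec
  simp only [badWords, Set.mem_ofPred_eq, not_forall, not_not] at hspec
  obtain ⟨u, hu⟩ := hspec
  refine ⟨k, u, ?_, fun m hm => not_not.1 (Nat.find_min hfin (by omega))⟩
  have h₁ := hu.inv
  rw [inv_inv, Nat.succ_eq_add_one, List.replicate_succ'] at h₁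
  exact h₁.mul (expand_pow_self b k [])

theorem replicate_bnot_mem_badWords {g : thompson K} {b : Bool}
    (hb : [!b] ∈ badWords (g : CantorGroup)⁻¹) (k j i : ℕ) :
    List.replicate (k + i + 1) (!b) ∈ badWords
      ((g * expand K b ^ k * copyX0 K b ^ j * expand K b ^ i : thompson K) : CantorGroup)⁻¹ := by
  have h₁ := mem_badWords_of_sends (expand_pow_not (K := K) b k []) hb
  rw [← List.replicate_succ', List.replicate_succ] at h₁
  have h₂ := mem_badWords_of_sends (copyX0_pow_not (K := K) b j _) h₁
  have h₃ := mem_badWords_of_sends (expand_pow_not (K := K) b i _) h₂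
  rwa [← List.replicate_succ, ← List.replicate_add, ← add_assoc, add_comm i] at h₃

theorem le_of_replicate_mem_badWords (hC : ∀ z : thompson K, (badWords z).ncard ≤ C * wlen z)
    {z : thompson K} {b : Bool} {n : ℕ}
    (h : List.replicate n b ∈ badWords (z : CantorGroup)⁻¹) : n + 1 ≤ C * wlen z := by
  have h₁ := le_ncard_badWords (inv_mem z.2) [] b (n := n + 1) fun m hm => by
    obtain ⟨t, rfl⟩ := Nat.exists_eq_add_of_le (Nat.lt_succ_iff.1 hm)
    rw [List.replicate_add] at h
    exact mem_badWords_of_append h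
  have h₂ := hC z⁻¹
  rw [wlen, wordLength_inv (closure_generators K)] at h₂
  exact h₁.trans h₂

theorem wlen_expand_pow_le (b : Bool) (n : ℕ) : wlen (expand K b ^ n) ≤ n :=
  (wordLength_pow_le (closure_generators K) _ n).trans
    (by simpa using Nat.mul_le_mul_left n (wordLength_letter_le (expand_letter (K := K) b)))

theorem wlen_copyX0_pow_le (b : Bool) (n : ℕ) : wlen (copyX0 K b ^ n) ≤ n * 4 :=
  (wordLength_pow_le (closure_generators K) _ n).trans
    (Nat.mul_le_mul_left n (wordLength_copyX0_le (K := K) b))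

theorem wlen_le_mul (g h : thompson K) : wlen g ≤ wlen (g * h) + wlen h :=
  wordLength_le_mul (closure_generators K) g h

theorem wlen_mul_le (g h : thompson K) : wlen (g * h) ≤ wlen g + wlen h :=
  wordLength_mul_le (closure_generators K) g h

theorem wlen_inv (g : thompson K) : wlen g⁻¹ = wlen g := wordLength_inv (closure_generators K) g

/-- While the cone of `b` is being expanded, the number of steps is bounded by `C` times the current
length, because the bad cone has sunk that deep. In the second stage the depth `k` of that cone and
the exponent `j` of the copy of `x₀` are both bounded in this way. If the current length is small,
few steps have been made, so `|g|` is small as well. -/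
theorem exists_reach_copyX0_pow (hC : ∀ z : thompson K, (badWords z).ncard ≤ C * wlen z)
    {g : thompson K} {b : Bool} (hb : [!b] ∈ badWords (g : CantorGroup)⁻¹) :
    ∃ k u, k + 1 ≤ C * wlen g ∧ Sends (g * expand K b ^ k : thompson K) u [b] ∧
      ∀ n, Reach (generators K) (fun v => wlen g ≤ (13 * C + 3) * wlen v) (k + n * 4) g
        (g * expand K b ^ k * copyX0 K b ^ n) := by
  obtain ⟨k, u, hu, hk⟩ := exists_expand hb
  refine ⟨k, u, le_of_replicate_mem_badWords hC (hk k le_rfl), hu, fun n => ?_⟩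
  have hA : ∀ i ≤ k, wlen g ≤ (13 * C + 3) * wlen (g * expand K b ^ i) := by
    intro i _
    have h₁ := replicate_bnot_mem_badWords hb i 0 0
    rw [pow_zero, pow_zero, mul_one, mul_one, add_zero] at h₁
    replace h₁ := le_of_replicate_mem_badWords hC h₁
    have h₂ := wlen_le_mul g (expand K b ^ i)
    have h₃ := wlen_expand_pow_le (K := K) b i
    nlinarith
  have hB : ∀ j i, i ≤ 2 → wlen g ≤
      (13 * C + 3) * wlen (g * expand K b ^ k * copyX0 K b ^ j * expand K b ^ i) := by
    intro j i hi
    set w := g * expand K b ^ k * copyX0 K b ^ j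
    have h₁ : k + i + 1 + 1 ≤ C * wlen (w * expand K b ^ i) :=
      le_of_replicate_mem_badWords hC (replicate_bnot_mem_badWords hb k j i)
    have h₂ : j ≤ C * wlen w :=
      (ActsBy.le_ncard w.2 (hu.actsBy.mul (copyX0_pow_actsBy b j))).trans (hC w)
    have h₃ := wlen_le_mul w (expand K b ^ i)
    have h₄ := wlen_expand_pow_le (K := K) b i
    have h₅ := wlen_le_mul (g * expand K b ^ k) (copyX0 K b ^ j)
    have h₆ := wlen_copyX0_pow_le (K := K) b j
    have h₇ := wlen_le_mul g (expand K b ^ k)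
    have h₈ := wlen_expand_pow_le (K := K) b k
    -- The surviving bad word shows that the vertex is not the identity. This lets the additive loss
    -- of at most two letters be absorbed by a factor `3`.
    have h₉ : 1 ≤ wlen (w * expand K b ^ i) := by
      rcases Nat.eq_zero_or_pos (wlen (w * expand K b ^ i)) with h | h
      · rw [h] at h₁; omega
      · exact h
    -- For the vertex `v = w * expand K b ^ i`: `|g| ≤ |w| + 4j + k` with `|w| ≤ 3|v|`, `j ≤ C|w|`
    -- and `k ≤ C|v|`, whence `3 + 12C + C = 13C + 3`.
    have h' : wlen w ≤ 3 * wlen (w * expand K b ^ i) := by omega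
    have h'' := Nat.mul_le_mul_left C h'
    change wlen (g * expand K b ^ k) ≤ wlen w + _ at h₅
    nlinarith
  refine Reach.trans (Reach.mono (Reach.pow (l := 1) (n := k) ?_ fun j hj => ?_) (by simp))
    (Reach.pow ?_ fun j _ => ?_)
  · simpa using hA 0 (Nat.zero_le _)
  · rw [pow_succ, ← mul_assoc]
    refine Reach.step (expand_letter b) (hA j hj.le) ?_
    rw [mul_assoc, ← pow_succ]
    exact hA _ hj
  · exact hA k le_rfl
  · rw [pow_succ, ← mul_assoc]
    refine reach_copyX0 (b := b) ?_ ?_ ?_ ?_ ?_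
    · simpa using hB j 0 (by norm_num)
    · simpa using hB j 1 (by norm_num)
    · exact hB j 2 le_rfl
    · rw [mul_assoc _ (copyX0 K b ^ j), ← pow_succ]
      simpa using hB (j + 1) 1 (by norm_num)
    · rw [mul_assoc _ (copyX0 K b ^ j), ← pow_succ]
      simpa using hB (j + 1) 0 (by norm_num)

/-! ### Changing the cone -/

/-- A conjugate of a copy of `x₀` that is supported in the cone of a word starting with the letter
other than `b'` fixes every word that starts with `b'`. -/
theorem sends_conj_copyX0 {w : CantorGroup} {u : Word} {b b' : Bool}
    (hw : Sends w ((!b') :: u) [b]) (n : ℕ) :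
    Sends (w * (copyX0 K b ^ n : thompson K) * w⁻¹) [b'] [b'] := by
  intro x
  set y := w.unop (prepend [b'] x) with hy
  have hy0 : y 0 = !b := by
    by_contra hne
    have hyb : y 0 = b := by cases h : y 0 <;> cases b <;> simp_all
    have h₁ : y = prepend [b] fun n => y (n + 1) := by
      rw [← hyb]; exact (consWord_eta y).symm
    rw [← hw, hy] at h₁
    have h₂ := w.unop.injective h₁
    have h₃ := (consWord_inj h₂).1
    simp at h₃
  have hfix : (copyX0 K b ^ n : thompson K).1.unop y = y := by
    rw [← consWord_eta y, hy0]
    exact copyX0_pow_not b n [] _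
  change w.unop.symm ((copyX0 K b ^ n : thompson K).1.unop (w.unop (prepend [b'] x))) = _
  rw [← hy, hfix, hy, Homeomorph.symm_apply_apply]

/-- The supports are disjoint: `f` is trivial on the cone of `b`, the copy of `x₀` outside it. -/
theorem commute_copyX0_pow {f : thompson K} {b : Bool} (hf : Sends f [b] [b]) (n : ℕ) :
    copyX0 K b ^ n * f = f * copyX0 K b ^ n := by
  have hact := copyX0_pow_actsBy (K := K) b n
  have hnot := copyX0_pow_not (K := K) b n []
  have key : ∀ x, f.1.unop ((copyX0 K b ^ n : thompson K).1.unop x) =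
      (copyX0 K b ^ n : thompson K).1.unop (f.1.unop x) := by
    intro x
    by_cases hx : x 0 = b
    · have h₁ : x = prepend [b] fun n => x (n + 1) := by
        rw [← hx]; exact (consWord_eta x).symm
      rw [h₁, hact, hf, hf, hact]
    · have hfix : ∀ y : Cantor, y 0 ≠ b → (copyX0 K b ^ n : thompson K).1.unop y = y := by
        intro y hy
        have hyb : y 0 = !b := by cases h : y 0 <;> cases b <;> simp_all
        rw [← consWord_eta y, hyb]
        exact hnot _
      have hfx : f.1.unop x 0 ≠ b := by
        intro h
        have h₁ : f.1.unop x = prepend [b] fun n => f.1.unop x (n + 1) := by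
          rw [← h]; exact (consWord_eta _).symm
        rw [← hf] at h₁
        exact hx (congrFun (f.1.unop.injective h₁) 0)
      rw [hfix x hx, hfix _ hfx]
  exact Subtype.ext (MulOpposite.unop_injective (Homeomorph.ext key))

theorem reach_mul_copyX0_pow {P : thompson K → Prop} {m : ℕ} (hP : ∀ v, m ≤ wlen v → P v)
    {z : thompson K} {b : Bool} {n : ℕ} (hz : ∀ j ≤ n, m + 4 ≤ wlen (z * copyX0 K b ^ j)) :
    Reach (generators K) P (n * 4) z (z * copyX0 K b ^ n) := by
  refine Reach.pow (hP _ ?_) fun j hj => ?_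
  · have := hz 0 (Nat.zero_le _)
    rw [pow_zero, mul_one] at this
    omega
  · rw [pow_succ, ← mul_assoc]
    refine Reach.mono (Reach.of_far (closure_generators K) fun v hv => hP v ?_)
      (wordLength_copyX0_le (K := K) b)
    have h₁ := hz j hj.le
    have h₂ := wordLength_copyX0_le (K := K) b
    simp only [wlen] at h₁ hv ⊢
    omega

/-- With `f = w * copyX0 K b ^ n * w⁻¹`, supported away from the cone of `b'`, the walk visits `f`,
then `f * copyX0 K b' ^ n = copyX0 K b' ^ n * f`, and then removes `f`. On every leg an action by
`x₀ ^ n` persists on some cone, up to multiplication by `w`. -/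
theorem reach_change_cone (hC : ∀ z : thompson K, (badWords z).ncard ≤ C * wlen z)
    {P : thompson K → Prop} {m : ℕ} (hP : ∀ v, m ≤ wlen v → P v) {w : thompson K} {u : Word}
    {b b' : Bool} (hw : Sends w ((!b') :: u) [b]) {n : ℕ} (hn : C * (m + wlen w + 4) < n) :
    Reach (generators K) P (n * 8 + 3 * wlen w) (w * copyX0 K b ^ n) (copyX0 K b' ^ n) := by
  -- The size of `n` leaves room for a detour of `|w|` letters, and for the at most four letters of
  -- one copy of `x₀`, before the length falls below `m`.
  have far : ∀ {z : thompson K} {p q : Word}, ActsBy z p q (genX0 ^ n) →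
      m + wlen w + 4 ≤ wlen z := fun {z p q} h => by
    have h₁ := (h.le_ncard z.2).trans (hC z)
    by_contra! h₂
    have := Nat.mul_le_mul_left C h₂.le
    omega
  have hX := closure_generators K
  have near : ∀ {z : thompson K} {s : thompson K} {p q : Word}, ActsBy z p q (genX0 ^ n) →
      wlen s = wlen w → Reach (generators K) P (wlen w) z (z * s) := fun {z s p q} h hs => by
    rw [← hs]
    refine Reach.of_far hX fun v hv => hP v ?_
    have := far h
    simp only [wlen] at this hs hv ⊢
    omega
  have hact := hw.actsBy.mul (copyX0_pow_actsBy (K := K) b n)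
  rw [one_mul] at hact
  set f := w * copyX0 K b ^ n * w⁻¹ with hf
  have hfact : ActsBy f ((!b') :: u) ((!b') :: u) (genX0 ^ n) := by
    have := hact.mul hw.inv.actsBy
    rwa [mul_one] at this
  have hcomm := commute_copyX0_pow (f := f) (sends_conj_copyX0 hw n) n
  have hb' := copyX0_pow_actsBy (K := K) b' n
  have r₁ : Reach (generators K) P (wlen w) (w * copyX0 K b ^ n) f := near hact (wlen_inv w)
  have r₂ : Reach (generators K) P (n * 4) f (f * copyX0 K b' ^ n) := by
    refine reach_mul_copyX0_pow hP fun j _ => ?_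
    have := hfact.mul (copyX0_pow_not (K := K) b' j u).actsBy
    rw [mul_one] at this
    have := far (z := f * copyX0 K b' ^ j) this
    omega
  -- A partial conjugate also fixes the cone of `b'`, so the action by `x₀ ^ n` there remains while
  -- the exponent `j` varies.
  have hconj : ∀ j, ActsBy (copyX0 K b' ^ n * (w * copyX0 K b ^ j * w⁻¹) : thompson K)
      [b'] [b'] (genX0 ^ n) := fun j => by
    have := hb'.mul (sends_conj_copyX0 (K := K) hw j).actsBy
    rwa [mul_one] at this
  have r₃ : Reach (generators K) P (wlen w) (copyX0 K b' ^ n * f)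
      (copyX0 K b' ^ n * w * copyX0 K b ^ n) := by
    have := near (hconj n) (s := w) rfl
    rwa [show copyX0 K b' ^ n * (w * copyX0 K b ^ n * w⁻¹) * w =
      copyX0 K b' ^ n * w * copyX0 K b ^ n by group] at this
  have r₄ : Reach (generators K) P (n * 4) (copyX0 K b' ^ n * w)
      (copyX0 K b' ^ n * w * copyX0 K b ^ n) := by
    refine reach_mul_copyX0_pow hP fun j _ => ?_
    have h₁ := far (hconj j)
    have h₂ := wlen_mul_le (copyX0 K b' ^ n * w * copyX0 K b ^ j) w⁻¹
    rw [wlen_inv, show copyX0 K b' ^ n * w * copyX0 K b ^ j * w⁻¹ =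
      copyX0 K b' ^ n * (w * copyX0 K b ^ j * w⁻¹) by group] at h₂
    omega
  have r₅ : Reach (generators K) P (wlen w) (copyX0 K b' ^ n) (copyX0 K b' ^ n * w) :=
    near hb' rfl
  rw [hcomm] at r₃
  exact ((((r₁.trans r₂).trans r₃).trans r₄.symm).trans r₅.symm).mono (by omega)

/-! ### Elements with few leaves -/

/-- The tree with two leaves. -/
def caret : PlaneTree := .node () .nil .nil

theorem leafNumber_one_le : leafNumber 1 ≤ 1 := by
  refine Nat.sInf_le ⟨⟨.nil, .nil, Equiv.refl _⟩, ?_, ?_, rfl⟩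
  · rintro ⟨u, v, ⟨i, hi, -⟩, -⟩
    have := List.get_mem (branches .nil) i
    rw [hi] at this
    simp [branches] at this
  · exact eq_of_sends (A := .nil) fun u hu => by
      obtain rfl : u = [] := by simpa [branches] using hu
      exact ⟨[], TreeDiagram.takes ⟨.nil, .nil, Equiv.refl _⟩ (0 : Fin 1), sends_one _⟩

theorem leafNumber_le_two {g : CantorGroup} (h : ∀ c : Bool, Sends g [c] [!c]) :
    leafNumber g ≤ 2 := by
  refine Nat.sInf_le ⟨⟨caret, caret, (Equiv.swap 0 1 : Equiv.Perm (Fin 2))⟩, ?_, ?_, rfl⟩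
  · rintro ⟨u, v, ⟨i, hi, hi'⟩, -⟩
    change Fin 2 at i
    fin_cases i
    · have h₁ : [true] = v ++ [false] := hi'
      have := congrArg List.getLast? h₁
      simp at this
    · have h₁ : [true] = u ++ [false] := hi
      have := congrArg List.getLast? h₁
      simp at this
  · refine eq_of_sends (A := caret) fun u hu => ?_
    obtain rfl | rfl : u = [false] ∨ u = [true] := by simpa [caret, branches] using hu
    · exact ⟨_, TreeDiagram.takes ⟨caret, caret, (Equiv.swap 0 1 : Equiv.Perm (Fin 2))⟩
        (0 : Fin 2), h false⟩
    · exact ⟨_, TreeDiagram.takes ⟨caret, caret, (Equiv.swap 0 1 : Equiv.Perm (Fin 2))⟩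
        (1 : Fin 2), h true⟩

/-- Otherwise both halves are images of cones by prefix exchange. Those two cones partition the
Cantor set, hence are the two halves, and `g` is the identity or the exchange of the halves, with at
most two leaves. -/
theorem exists_mem_badWords_inv {g : CantorGroup} (hg : 4 ≤ leafNumber g) :
    ∃ b : Bool, [!b] ∈ badWords g⁻¹ := by
  by_contra! h
  have h' : ∀ c : Bool, ∃ u, Sends g⁻¹ [c] u := fun c => by
    have := h (!c)
    simpa [badWords] using this
  choose p hp using h'
  have hcover : ∀ x, ∃ c y, x = prepend (p c) y := fun x => by
    refine ⟨g.unop x 0, fun n => g.unop x (n + 1), ?_⟩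
    rw [← hp]
    exact (g.unop.symm_apply_apply x).symm.trans (congrArg g.unop.symm (consWord_eta _).symm)
  have hdisj : ∀ c d x y, prepend (p c) x = prepend (p d) y → c = d := fun c d x y hxy => by
    rw [← hp, ← hp] at hxy
    exact (consWord_inj (g⁻¹.unop.injective hxy)).1
  have hne : ∀ c, ∃ a t, p c = a :: t := fun c => by
    cases hc : p c with
    | cons a t => exact ⟨a, t, rfl⟩
    | nil =>
      have := hdisj c (!c) (prepend (p !c) fun _ => false) (fun _ => false) (by rw [hc]; rfl)
      simp at this
  choose a t hat using hne
  have ha : ∀ c, a (!c) = !(a c) := fun c => by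
    obtain ⟨d, y, hd⟩ := hcover (consWord (!(a c)) fun _ => false)
    rw [hat, prepend_cons] at hd
    have h₁ := (consWord_inj hd).1
    have : d = !c := by
      by_contra hdc
      have hdc' : d = c := by cases c <;> cases d <;> simp_all
      rw [hdc'] at h₁
      simp at h₁
    rw [← this, ← h₁]
  -- If the cone of `p c` were smaller than a half, an infinite word with the same first letter and
  -- the opposite second one would lie in neither cone.
  have ht : ∀ c, t c = [] := fun c => by
    cases htc : t c with
    | nil => rfl
    | cons e s =>
      obtain ⟨d, y, hd⟩ := hcover (consWord (a c) fun _ => !e)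
      rw [hat, prepend_cons] at hd
      obtain ⟨h₁, h₂⟩ := consWord_inj hd
      have hdc : d = c := by
        by_contra hdc
        have hdc' : d = !c := by cases c <;> cases d <;> simp_all
        rw [hdc', ha] at h₁
        simp at h₁
      rw [hdc, htc, prepend_cons] at h₂
      have := congrFun h₂ 0
      simp [consWord] at this
  have hs : ∀ c, Sends g [a c] [c] := fun c => by
    have := (hp c).inv
    rwa [inv_inv, hat, ht] at this
  have ha1 : a true = !(a false) := ha false
  cases hf : a false with
  | false =>
    have h₀ := hs false
    have h₁ := hs true
    rw [ha1] at h₁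
    rw [hf] at h₀ h₁
    have : g = 1 := eq_of_sends (A := caret) fun u hu => by
      obtain rfl | rfl : u = [false] ∨ u = [true] := by simpa [caret, branches] using hu
      exacts [⟨_, h₀, sends_one _⟩, ⟨_, h₁, sends_one _⟩]
    rw [this] at hg
    have := leafNumber_one_le
    omega
  | true =>
    have h₀ := hs false
    have h₁ := hs true
    rw [ha1] at h₁
    rw [hf] at h₀ h₁
    have := leafNumber_le_two (g := g) fun c => by cases c; exacts [h₁, h₀]
    omega

theorem ne_nil_of_sends {g : CantorGroup} {u : Word} {b : Bool} (h : Sends g u [b]) : u ≠ [] := by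
  rintro rfl
  have h₁ := h (g.unop.symm fun _ => !b)
  rw [prepend_nil, Homeomorph.apply_symm_apply] at h₁
  have := congrFun h₁ 0
  simp [prepend, consWord] at this

/-! ### The theorem -/

/-- The endpoint depends only on `n`, so walks from two elements can be glued there. The length is
at most `k + 4n` for leaving `g`, `8n + 3|w|` for the change of cone and `8n` for a possible second
change; then `k ≤ C|g|` and `|w| ≤ (C + 1)|g|`. -/
theorem exists_reach_tx1_pow (hC : ∀ z : thompson K, (badWords z).ncard ≤ C * wlen z)
    {g : thompson K} (hg : 4 ≤ leafNumber (g : CantorGroup)) :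
    0 < wlen g ∧ ∀ n m, m ≤ wlen g → C * (m + (C + 1) * wlen g + 4) < n →
      Reach (generators K) (fun v => m ≤ (13 * C + 3) * wlen v)
        (20 * n + (4 * C + 3) * wlen g) g (tx1 K ^ n) := by
  obtain ⟨b, hb⟩ := exists_mem_badWords_inv hg
  obtain ⟨k, u, hk, hu, hr⟩ := exists_reach_copyX0_pow hC hb
  have hpos : 0 < wlen g := by
    rcases Nat.eq_zero_or_pos (wlen g) with h | h
    · rw [h] at hk; omega
    · exact h
  refine ⟨hpos, fun n m hm hn => ?_⟩
  have hP : ∀ v : thompson K, m ≤ wlen v → m ≤ (13 * C + 3) * wlen v := fun v hv => by nlinarith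
  set w := g * expand K b ^ k
  have hw : wlen w ≤ (C + 1) * wlen g := by
    have h₁ := wlen_mul_le g (expand K b ^ k)
    have h₂ := wlen_expand_pow_le (K := K) b k
    change wlen w ≤ _ at h₁
    rw [Nat.succ_mul]
    omega
  obtain ⟨p, hp₁, hp₂⟩ := hr n
  have r₁ : Reach (generators K) (fun v => m ≤ (13 * C + 3) * wlen v) (k + n * 4) g
      (w * copyX0 K b ^ n) := ⟨p, hp₁, fun v hv => hm.trans (hp₂ v hv)⟩
  -- The first letter `c` of `u` tells which half contains the support of the conjugate; the other
  -- half, `!c`, receives the new copy of `x₀`.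
  obtain ⟨c, t, rfl⟩ := List.exists_cons_of_ne_nil (ne_nil_of_sends hu)
  have r₂ : Reach (generators K) (fun v => m ≤ (13 * C + 3) * wlen v) (n * 8 + 3 * wlen w)
      (w * copyX0 K b ^ n) (copyX0 K (!c) ^ n) := by
    refine reach_change_cone hC hP (u := t) (by rw [Bool.not_not]; exact hu)
      (lt_of_le_of_lt (Nat.mul_le_mul_left C ?_) hn)
    omega
  have r₃ : Reach (generators K) (fun v => m ≤ (13 * C + 3) * wlen v) (n * 8)
      (copyX0 K (!c) ^ n) (tx1 K ^ n) := by
    cases c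
    · exact r₂.refl_right
    -- If the new copy lives in the cone of `0`, a second change of cone with `w = 1` moves it to
    -- the cone of `1`, where it is `x₁`.
    · have h₁ : wlen (1 : thompson K) = 0 := wordLength_one
      have := reach_change_cone hC hP (w := 1) (u := []) (b := false) (b' := true) (sends_one _)
        (n := n) (lt_of_le_of_lt (Nat.mul_le_mul_left C (by omega)) hn)
      rwa [h₁, one_mul] at this
  refine ((r₁.trans r₂).trans r₃).mono ?_
  have := Nat.mul_le_mul_left 3 hw
  nlinarith

end Thompson

theorem mainTheorem1 (K : Thompson.Kind) :
    ∃ δ D : ℝ, 0 < δ ∧ 0 < D ∧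
      ∀ g₁ g₂ : Thompson.thompson K,
        4 ≤ Thompson.leafNumber (g₁ : Thompson.CantorGroup) →
        4 ≤ Thompson.leafNumber (g₂ : Thompson.CantorGroup) →
        ∃ p : (SimpleGraph.mulCayley (Thompson.generators K)).Walk g₁ g₂,
          (p.length : ℝ) ≤
            D * (Thompson.wordLength (Thompson.generators K) g₁ +
              Thompson.wordLength (Thompson.generators K) g₂) ∧
          ∀ v ∈ p.support,
            δ * min (Thompson.wordLength (Thompson.generators K) g₁ : ℝ)
                (Thompson.wordLength (Thompson.generators K) g₂ : ℝ) <
              Thompson.wordLength (Thompson.generators K) v := by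
  obtain ⟨C, hC⟩ := Thompson.exists_ncard_badWords_le K
  -- The factor `2` in the denominator makes the inequality strict, since both lengths are positive.
  -- The factor `40` comes from the two walks of length `20n + …`.
  refine ⟨1 / (2 * (13 * C + 3)), 40 * (C * (C + 6) + 1) + (4 * C + 3), by positivity,
    by positivity, fun g₁ g₂ h₁ h₂ => ?_⟩
  obtain ⟨hpos₁, r₁⟩ := Thompson.exists_reach_tx1_pow hC h₁
  obtain ⟨hpos₂, r₂⟩ := Thompson.exists_reach_tx1_pow hC h₂
  set a := Thompson.wordLength (Thompson.generators K) g₁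
  set b := Thompson.wordLength (Thompson.generators K) g₂
  change 0 < a at hpos₁
  change 0 < b at hpos₂
  -- As `a + b ≥ 1`, the constant `4` is at most `4(a + b)`, which gives the factor `C + 6`; the
  -- summand `1` makes the bounds on `n` strict.
  set n := (C * (C + 6) + 1) * (a + b) with hn
  have hna : C * (min a b + (C + 1) * a + 4) < n := by
    have : min a b + (C + 1) * a + 4 ≤ (C + 6) * (a + b) := by
      have := min_le_left a b
      nlinarith
    have := Nat.mul_le_mul_left C this
    nlinarith
  have hnb : C * (min a b + (C + 1) * b + 4) < n := by
    have : min a b + (C + 1) * b + 4 ≤ (C + 6) * (a + b) := by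
      have := min_le_right a b
      nlinarith
    have := Nat.mul_le_mul_left C this
    nlinarith
  obtain ⟨p, hp, hv⟩ := (r₁ n (min a b) (min_le_left _ _) hna).trans
    (r₂ n (min a b) (min_le_right _ _) hnb).symm
  refine ⟨p, ?_, fun v hvp => ?_⟩
  · have hp' : p.length ≤ (40 * (C * (C + 6) + 1) + (4 * C + 3)) * (a + b) := by
      refine hp.trans (le_of_eq ?_)
      rw [hn]
      ring
    exact_mod_cast hp'
  · have h := hv v hvp
    rw [div_mul_eq_mul_div, one_mul, div_lt_iff₀ (by positivity)]
    have hmin : 0 < min a b := lt_min hpos₁ hpos₂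
    have h' : min a b < Thompson.wordLength (Thompson.generators K) v *
        (2 * (13 * C + 3)) := by
      simp only [Thompson.wlen] at h
      nlinarith
    exact_mod_cast h'
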